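/- Let $\Omega\subset\mathbb{C}^2$ be a bounded pseudoconvex domain with smooth boundary, i.e. there is a smooth defining function $\rho:\mathbb{C}^2\to\mathbb{R}$ with $\Omega=\{\rho<0\}$, $\partial\Omega=\{\rho=0\}$ and $d\rho\neq0$ on $\partial\Omega$. With coordinates $(z,w)=(z_1,z_2)$ put $$L=\frac{1}{\sqrt{|\rho_z|^2+|\rho_w|^2}}\Big(\rho_w\frac{\partial}{\partial z}-\rho_z\frac{\partial}{\partial w}\Big)=\sum_j L_j\frac{\partial}{\partial z_j}$$ on $\partial\Omega$, the normalized holomorphic tangential vector field. Pseudoconvexity means that the Levi form $\sum_{j,k}\frac{\partial^2\rho}{\partial z_j\partial\bar z_k}L_j\overline{L_k}$ is nonnegative on $\partial\Omega$; the Levi-flat set $\Sigma$ is the set of points of $\partial\Omega$ at which the Levi form vanishes. The Diederich–Fornæss index of $\Omega$ is the supremum of all $\tau\in(0,1)$ for which there is a smooth defining function $r$ of $\Omega$ such that $-(-r)^{\tau}$ is plurisubharmonic on $\Omega$. A real curve is the image of a smooth map $\gamma:[a,b]\to\mathbb{C}^2$, $a<b$, that is injective except that $\gamma(a)=\gamma(b)$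 is allowed; it is transversal to $L$ if $\gamma'(t)$, $\operatorname{Re}L$ and $\operatorname{Im}L$ at $\gamma(t)$ are linearly independent over $\mathbb{R}$ for every $t\in[a,b]$. (i) If every point of $\Sigma$ is an isolated point of $\Sigma$, then the Diederich–Fornæss index of $\Omega$ is $1$. (ii) If $\Sigma$ is the union of a finite set of isolated points of $\Sigma$ and of finitely many pairwise disjoint real curves transversal to $L$ (either family may be empty), then the Diederich–Fornæss index of $\Omega$ is $1$. -/

import Mathlib

open Set Filter Topology
open scoped ContDiff

noncomputable section

/-- The space `ℂ²` of pairs `(z, w)`, with its Euclidean norm; `z` is the coordinate `0` and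
`w` is the coordinate `1`. -/
abbrev C2 : Type := EuclideanSpace ℂ (Fin 2)

/-- The Wirtinger derivative `∂f/∂z_j = (∂f/∂x_j - i ∂f/∂y_j) / 2` (with `z_j = x_j + i y_j`). -/
def wirtinger (j : Fin 2) (f : C2 → ℂ) (p : C2) : ℂ :=
  (1 / 2 : ℂ) * (fderiv ℝ f p (EuclideanSpace.single j (1 : ℂ))
    - Complex.I * fderiv ℝ f p (EuclideanSpace.single j Complex.I))

/-- The Wirtinger derivative `∂f/∂z̄_j = (∂f/∂x_j + i ∂f/∂y_j) / 2`. -/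
def wirtingerBar (j : Fin 2) (f : C2 → ℂ) (p : C2) : ℂ :=
  (1 / 2 : ℂ) * (fderiv ℝ f p (EuclideanSpace.single j (1 : ℂ))
    + Complex.I * fderiv ℝ f p (EuclideanSpace.single j Complex.I))

/-- The complex Hessian `Hess_f(Z, W) = ∑ⱼₖ (∂²f/∂z_j∂z̄_k) Z_j conj(W_k)` at `p` of a real function,
for holomorphic tangent vectors `Z = ∑ Z_j ∂/∂z_j` and `W = ∑ W_k ∂/∂z_k`. -/
def complexHessian (f : C2 → ℝ) (Z W : C2) (p : C2) : ℂ :=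
  ∑ j : Fin 2, ∑ k : Fin 2,
    wirtinger j (fun q => wirtingerBar k (fun x => (f x : ℂ)) q) p * Z j * star (W k)

/-- `ρ` is a (smooth) defining function of `Ω ⊆ ℂ²`. The set `Ω` has smooth boundary when it has
a defining function. -/
structure IsDefiningFunction (Ω : Set C2) (ρ : C2 → ℝ) : Prop where
  smooth : ContDiff ℝ ∞ ρ
  eq_neg : Ω = {p | ρ p < 0}
  frontier_eq : frontier Ω = {p | ρ p = 0}
  fderiv_ne_zero : ∀ p ∈ frontier Ω, fderiv ℝ ρ p ≠ 0

/-- The normalized holomorphic tangential vector field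
`L = (|ρ_z|² + |ρ_w|²)^(-1/2) (ρ_w ∂/∂z - ρ_z ∂/∂w)`, given by its components. -/
def tangentialField (ρ : C2 → ℝ) (p : C2) : C2 :=
  let ρz : ℂ := wirtinger 0 (fun x => (ρ x : ℂ)) p
  let ρw : ℂ := wirtinger 1 (fun x => (ρ x : ℂ)) p
  (Real.sqrt (‖ρz‖ ^ 2 + ‖ρw‖ ^ 2))⁻¹ • !₂[ρw, -ρz]

/-- The Levi form `Hess_ρ(L, L)` of the boundary at `p`, in the tangential direction `L`
(which spans the holomorphic tangent space of the boundary). -/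
def leviForm (ρ : C2 → ℝ) (p : C2) : ℂ :=
  complexHessian ρ (tangentialField ρ p) (tangentialField ρ p) p

/-- (Levi) pseudoconvexity of a domain with defining function `ρ`: the Levi form, a real number,
is nonnegative at each boundary point. -/
def IsLeviPseudoconvex (Ω : Set C2) (ρ : C2 → ℝ) : Prop :=
  ∀ p ∈ frontier Ω, 0 ≤ (leviForm ρ p).re

/-- The Levi-flat set: the boundary points at which the Levi form vanishes. -/
def leviFlatSet (Ω : Set C2) (ρ : C2 → ℝ) : Set C2 :=
  {p ∈ frontier Ω | leviForm ρ p = 0}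

/-- A real-valued function `u` is plurisubharmonic on the open set `Ω`: it is upper semicontinuous
and satisfies the sub-mean value inequality on each closed disc, in each complex line, that lies in
`Ω` (a plurisubharmonic function with finite values is automatically integrable on such circles). -/
def PlurisubharmonicOn (u : C2 → ℝ) (Ω : Set C2) : Prop :=
  UpperSemicontinuousOn u Ω ∧
    ∀ p v : C2, (∀ ζ : ℂ, ‖ζ‖ ≤ 1 → p + ζ • v ∈ Ω) →
      CircleIntegrable (fun ζ : ℂ => u (p + ζ • v)) 0 1 ∧
        u p ≤ Real.circleAverage (fun ζ : ℂ => u (p + ζ • v)) 0 1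

/-- The Diederich–Fornæss exponents of `Ω`: the `τ ∈ (0, 1)` such that `-(-ρ)^τ` is
plurisubharmonic on `Ω` for some defining function `ρ` of `Ω`. -/
def dfExponents (Ω : Set C2) : Set ℝ :=
  {τ | 0 < τ ∧ τ < 1 ∧
    ∃ ρ : C2 → ℝ, IsDefiningFunction Ω ρ ∧ PlurisubharmonicOn (fun p => -((-ρ p) ^ τ)) Ω}

/-- The Diederich–Fornæss index of `Ω`. -/
def dfIndex (Ω : Set C2) : ℝ := sSup (dfExponents Ω)

/-- A real curve in `ℂ²`: a simple (possibly closed) curve parametrized by a smooth map on a compact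
interval `[a, b]`. -/
structure RealCurve where
  toFun : ℝ → C2
  a : ℝ
  b : ℝ
  lt : a < b
  smooth : ContDiff ℝ ∞ toFun
  /-- No two parameters have the same image, except possibly the two end points. -/
  simple : ∀ s ∈ Icc a b, ∀ t ∈ Icc a b, s < t → toFun s = toFun t → s = a ∧ t = b

/-- The set of points of a real curve. -/
def RealCurve.carrier (γ : RealCurve) : Set C2 := γ.toFun '' Icc γ.a γ.b

/-- The real tangent vector `Re Z` for `Z = f ∂/∂z + g ∂/∂w`, under the identification of real
tangent vectors of `ℂ² = ℝ⁴` with elements of `ℂ²`. -/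
def rePart (Z : C2) : C2 := (1 / 2 : ℂ) • Z

/-- The real tangent vector `Im Z` for `Z = f ∂/∂z + g ∂/∂w`. -/
def imPart (Z : C2) : C2 := (-Complex.I / 2) • Z

/-- The curve is transversal to the holomorphic vector field `L`: at each of its points `γ'`,
`Re L` and `Im L` are linearly independent over `ℝ`. -/
def RealCurve.IsTransversal (γ : RealCurve) (L : C2 → C2) : Prop :=
  ∀ t ∈ Icc γ.a γ.b,
    LinearIndependent ℝ ![deriv γ.toFun t, rePart (L (γ.toFun t)), imPart (L (γ.toFun t))]

/-- `p` is an isolated point of `S`. -/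
def IsIsolatedPt (S : Set C2) (p : C2) : Prop := p ∈ S ∧ ¬ AccPt p (𝓟 S)

end

noncomputable section

open MeasureTheory

/-! Write `Q f X` for the Levi form of `f` and `|∂f(X)|²` for its gradient square, both up to the
factor 4. In both cases the Levi-flat set `Σ` is covered by `O(1/r)` balls of radius `r`: it is a
finite set, or a finite set together with finitely many Lipschitz curves. Sets this thin carry
plurisubharmonic functions `lam` with `0 ≤ lam ≤ 1` on `Ω` and Levi form as large as desired near
`Σ`: sum `M r² log (1 + |p - a|² / r²)` over the centres `a`. Near `Σ` the Levi form is at least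
`M`, while the sum is `O(√r)` (`HasLinearCovering.exists_plurisubharmonic`).

Fix `τ < 1` and try the defining function `r = ρ exp (-c e^lam)`. With `w = log (-r)`, the function
`-(-r)^τ = -e^(τ w)` is plurisubharmonic where `Q w + τ |∂w|² ≤ 0`. If `c` is small compared with `1
- τ`, the gradient of `lam` is absorbed (`cross_term_le`), and it suffices that `-ρ Q ρ + σ |∂ρ|² +
c ρ² Q lam ≥ 0` with `σ = (1 - τ) / 2` (`realLevi_logDistance_add_le`).

Pseudoconvexity and metric regularity of the bundle of complex tangent vectors give `Q ρ ≥ -C (|ρ| +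
|∂ρ(X)|)` near null directions of `∂ρ`, so the first two terms are at least `-M ρ²` near the
boundary, with `M` independent of `lam`. Near `Σ` the term `c ρ² Q lam` makes up for this; elsewhere
on the boundary either `Q ρ` or `|∂ρ|²` is positive (`exists_forall_nonneg_near_frontier`).

This settles a neighbourhood of the boundary. A convex truncation makes the function constant deep
inside `Ω`, and it is still of the form `-(-r)^τ` for another defining function. Hence every `τ` in
`(0, 1)` is an exponent. -/

/-! ### From a nonnegative Levi form to the sub-mean value inequality -/

lemma hasDerivAt_intervalIntegral_of_continuousOn {F F' : ℝ → ℝ → ℝ} {a b c d x : ℝ}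
    (hx : x ∈ Ioo a b) (hF : ∀ s ∈ Ioo a b, Continuous (F s))
    (hF' : ContinuousOn (fun y : ℝ × ℝ => F' y.1 y.2) (Ioo a b ×ˢ univ))
    (hd : ∀ s ∈ Ioo a b, ∀ θ, HasDerivAt (fun s => F s θ) (F' s θ) s) :
    HasDerivAt (fun s => ∫ θ in c..d, F s θ) (∫ θ in c..d, F' x θ) x := by
  obtain ⟨ε, hε, hball⟩ := Metric.nhds_basis_closedBall.mem_iff.1 (Ioo_mem_nhds hx.1 hx.2)
  have hK : IsCompact (Metric.closedBall x ε ×ˢ uIcc c d) :=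
    (isCompact_closedBall x ε).prod isCompact_uIcc
  obtain ⟨C, hC⟩ := hK.exists_bound_of_continuousOn
    (hF'.mono (prod_mono hball (subset_univ _)))
  have hcont : ∀ s ∈ Ioo a b, Continuous (F' s) := fun s hs =>
    hF'.comp_continuous (Continuous.prodMk continuous_const continuous_id)
      (fun θ => ⟨hs, mem_univ _⟩)
  refine (intervalIntegral.hasDerivAt_integral_of_dominated_loc_of_deriv_le
    (F := F) (F' := F') (bound := fun _ => C) (Metric.closedBall_mem_nhds x hε) ?_ ?_ ?_ ?_ ?_ ?_).2
  · filter_upwards [Ioo_mem_nhds hx.1 hx.2] with s hs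
    exact (hF s hs).aestronglyMeasurable
  · exact (hF x hx).intervalIntegrable _ _
  · exact (hcont x hx).aestronglyMeasurable
  · exact Eventually.of_forall fun θ hθ s hs => hC (s, θ) ⟨hs, uIoc_subset_uIcc hθ⟩
  · exact intervalIntegrable_const
  · exact Eventually.of_forall fun θ _ s hs => hd s (hball hs) θ

/-- Room beyond the unit circle lets the circle means be differentiated on an open interval of radii
containing `[0, 1]`. -/
lemma exists_one_lt_forall_mem_of_closedDisc {E : Type*} [NormedAddCommGroup E]
    [NormedSpace ℂ E] {Ω : Set E} (hΩ : IsOpen Ω) {p v : E}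
    (h : ∀ ζ : ℂ, ‖ζ‖ ≤ 1 → p + ζ • v ∈ Ω) :
    ∃ R : ℝ, 1 < R ∧ ∀ ζ : ℂ, ‖ζ‖ < R → p + ζ • v ∈ Ω := by
  have hopen : IsOpen ((fun ζ : ℂ => p + ζ • v) ⁻¹' Ω) := hΩ.preimage (by fun_prop)
  obtain ⟨δ, hδ, hsub⟩ := (isCompact_closedBall (0 : ℂ) 1).exists_thickening_subset_open hopen
    (fun ζ hζ => h ζ (by simpa using hζ))
  refine ⟨1 + δ, by linarith, fun ζ hζ => hsub ?_⟩
  rw [thickening_closedBall hδ zero_le_one]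
  simpa [add_comm] using hζ

section RealSpace

variable {E : Type*} [NormedAddCommGroup E] [NormedSpace ℝ E] {f : E → ℝ} {Ω : Set E}

lemma hasFDerivAt_of_contDiffOn_two (hΩ : IsOpen Ω) (hf : ContDiffOn ℝ 2 f Ω) {q : E}
    (hq : q ∈ Ω) : HasFDerivAt f (fderiv ℝ f q) q :=
  (((hf.contDiffAt (hΩ.mem_nhds hq)).differentiableAt (by norm_num))).hasFDerivAt

lemma hasFDerivAt_fderiv_of_contDiffOn_two (hΩ : IsOpen Ω) (hf : ContDiffOn ℝ 2 f Ω) {q : E}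
    (hq : q ∈ Ω) : HasFDerivAt (fderiv ℝ f) (fderiv ℝ (fderiv ℝ f) q) q :=
  (((hf.fderiv_of_isOpen (m := 1) hΩ (by norm_num)).contDiffAt
    (hΩ.mem_nhds hq)).differentiableAt (by norm_num)).hasFDerivAt

lemma continuousOn_fderiv_fderiv_of_contDiffOn_two (hΩ : IsOpen Ω) (hf : ContDiffOn ℝ 2 f Ω) :
    ContinuousOn (fderiv ℝ (fderiv ℝ f)) Ω :=
  ((hf.fderiv_of_isOpen (m := 1) hΩ (by norm_num)).fderiv_of_isOpen (m := 0) hΩ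
    (by norm_num)).continuousOn

end RealSpace

section Levi

variable {E : Type*} [NormedAddCommGroup E] [NormedSpace ℂ E] [NormedSpace ℝ E]

/-- The real Levi form `D²f(X, X) + D²f(iX, iX)`, which is four times the complex Hessian. -/
def realLevi (f : E → ℝ) (p X : E) : ℝ :=
  fderiv ℝ (fderiv ℝ f) p X X +
    fderiv ℝ (fderiv ℝ f) p (Complex.I • X) (Complex.I • X)

/-- The form `df(X)² + df(iX)²`, which is `4 |∂f(X)|²`. -/
def gradSq (f : E → ℝ) (p X : E) : ℝ :=
  fderiv ℝ f p X ^ 2 + fderiv ℝ f p (Complex.I • X) ^ 2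

lemma gradSq_nonneg (f : E → ℝ) (p X : E) : 0 ≤ gradSq f p X := by
  unfold gradSq; positivity

variable {f : E → ℝ} {Ω : Set E}

/-- Polar form of the Laplacian: if `φ s` is the integral of `f` over the circle of radius `s`, then
`(s φ')' = s ∫ realLevi f ≥ 0`. So `s φ'` increases from `0`, whence `φ' ≥ 0` and `φ 0 ≤ φ 1`. -/
theorem subMean_of_realLevi_nonneg [IsScalarTower ℝ ℂ E] (hΩ : IsOpen Ω) (hf : ContDiffOn ℝ 2 f Ω)
    (hQ : ∀ p ∈ Ω, ∀ X, 0 ≤ realLevi f p X) {p v : E}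
    (h : ∀ ζ : ℂ, ‖ζ‖ ≤ 1 → p + ζ • v ∈ Ω) :
    CircleIntegrable (fun ζ : ℂ => f (p + ζ • v)) 0 1 ∧
      f p ≤ Real.circleAverage (fun ζ : ℂ => f (p + ζ • v)) 0 1 := by
  obtain ⟨R, hR, hmem⟩ := exists_one_lt_forall_mem_of_closedDisc hΩ h
  set e : ℝ → E := fun θ => Complex.exp (θ * Complex.I) • v with he
  have hsmul : ∀ (s : ℝ) (θ : ℝ), s • e θ = ((s : ℂ) * Complex.exp (θ * Complex.I)) • v := by
    intro s θ
    simp only [he]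
    rw [mul_smul]
    exact (algebraMap_smul ℂ s _).symm
  have hq : ∀ s ∈ Ioo (-R) R, ∀ θ, p + s • e θ ∈ Ω := by
    intro s hs θ
    rw [hsmul]
    refine hmem _ ?_
    rw [norm_mul, Complex.norm_exp_ofReal_mul_I, mul_one, Complex.norm_real, Real.norm_eq_abs]
    exact abs_lt.2 hs
  have hecont : Continuous e := by rw [he]; fun_prop
  have hed : ∀ θ, HasDerivAt e (Complex.I • e θ) θ := by
    intro θ
    have h1 : HasDerivAt (fun θ : ℝ => Complex.exp (θ * Complex.I))
        (Complex.exp (θ * Complex.I) * (1 * Complex.I)) θ :=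
      ((Complex.ofRealCLM.hasDerivAt).mul_const Complex.I).cexp
    convert h1.smul_const v using 1
    simp only [he, smul_smul, one_mul, mul_comm Complex.I]
  have hqs : ∀ s θ : ℝ, HasDerivAt (fun s : ℝ => p + s • e θ) (e θ) s := by
    intro s θ
    simpa using ((hasDerivAt_id s).smul_const (e θ)).const_add p
  have hqθ : ∀ s θ : ℝ, HasDerivAt (fun θ : ℝ => p + s • e θ) (s • Complex.I • e θ) θ := by
    intro s θ
    exact ((hed θ).const_smul s).const_add p
  have hqc : ContinuousOn (fun y : ℝ × ℝ => p + y.1 • e y.2) (Ioo (-R) R ×ˢ univ) := by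
    apply Continuous.continuousOn; fun_prop
  have hmaps : MapsTo (fun y : ℝ × ℝ => p + y.1 • e y.2) (Ioo (-R) R ×ˢ univ) Ω :=
    fun y hy => hq _ hy.1 _
  have hc0 : ContinuousOn (fun y : ℝ × ℝ => f (p + y.1 • e y.2)) (Ioo (-R) R ×ˢ univ) :=
    hf.continuousOn.comp hqc hmaps
  have hc1 : ContinuousOn (fun y : ℝ × ℝ => fderiv ℝ f (p + y.1 • e y.2) (e y.2))
      (Ioo (-R) R ×ˢ univ) :=
    (((hf.continuousOn_fderiv_of_isOpen hΩ (by norm_num))).comp hqc hmaps).clm_apply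
      (by fun_prop)
  have hc2 : ∀ X : ℝ → E, Continuous X → ContinuousOn (fun y : ℝ × ℝ =>
      fderiv ℝ (fderiv ℝ f) (p + y.1 • e y.2) (X y.2) (X y.2)) (Ioo (-R) R ×ˢ univ) := by
    intro X hX
    exact (((continuousOn_fderiv_fderiv_of_contDiffOn_two hΩ hf).comp hqc hmaps).clm_apply
      (by fun_prop)).clm_apply (by fun_prop)
  have slice : ∀ {G : ℝ × ℝ → ℝ}, ContinuousOn G (Ioo (-R) R ×ˢ univ) →
      ∀ s ∈ Ioo (-R) R, Continuous fun θ => G (s, θ) := fun hG s hs =>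
    hG.comp_continuous (Continuous.prodMk continuous_const continuous_id)
      (fun θ => ⟨hs, mem_univ _⟩)
  -- first derivative of the circle integrals
  set φ : ℝ → ℝ := fun s => ∫ θ in (0)..(2 * Real.pi), f (p + s • e θ) with hφ
  set φ1 : ℝ → ℝ := fun s => ∫ θ in (0)..(2 * Real.pi), fderiv ℝ f (p + s • e θ) (e θ) with hφ1
  set φ2 : ℝ → ℝ := fun s => ∫ θ in (0)..(2 * Real.pi),
    fderiv ℝ (fderiv ℝ f) (p + s • e θ) (e θ) (e θ) with hφ2
  have hd1 : ∀ s ∈ Ioo (-R) R, HasDerivAt φ (φ1 s) s := by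
    intro s hs
    refine hasDerivAt_intervalIntegral_of_continuousOn hs (F := fun s θ => f (p + s • e θ))
      (F' := fun s θ => fderiv ℝ f (p + s • e θ) (e θ)) (slice hc0)
      hc1 ?_
    intro s hs θ
    exact (hasFDerivAt_of_contDiffOn_two hΩ hf (hq s hs θ)).comp_hasDerivAt s (hqs s θ)
  have hd2 : ∀ s ∈ Ioo (-R) R, HasDerivAt φ1 (φ2 s) s := by
    intro s hs
    refine hasDerivAt_intervalIntegral_of_continuousOn hs
      (F := fun s θ => fderiv ℝ f (p + s • e θ) (e θ))
      (F' := fun s θ => fderiv ℝ (fderiv ℝ f) (p + s • e θ) (e θ) (e θ))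
      (slice hc1) (hc2 e hecont) ?_
    intro s hs θ
    have h1 : HasDerivAt (fun s => fderiv ℝ f (p + s • e θ))
        (fderiv ℝ (fderiv ℝ f) (p + s • e θ) (e θ)) s :=
      (hasFDerivAt_fderiv_of_contDiffOn_two hΩ hf (hq s hs θ)).comp_hasDerivAt s (hqs s θ)
    simpa using h1.clm_apply (hasDerivAt_const s (e θ))
  -- Integration by parts in the angle: the derivative of the periodic function `df(i e θ)` has
  -- integral zero, which turns the radial derivative into the tangential half of the Levi form.
  have hparts : ∀ s ∈ Ioo (-R) R, φ1 s = s * ∫ θ in (0)..(2 * Real.pi),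
      fderiv ℝ (fderiv ℝ f) (p + s • e θ) (Complex.I • e θ) (Complex.I • e θ) := by
    intro s hs
    have hderiv : ∀ θ ∈ uIcc 0 (2 * Real.pi),
        HasDerivAt (fun θ => fderiv ℝ f (p + s • e θ) (Complex.I • e θ))
        (s * fderiv ℝ (fderiv ℝ f) (p + s • e θ) (Complex.I • e θ) (Complex.I • e θ)
          - fderiv ℝ f (p + s • e θ) (e θ)) θ := by
      intro θ _
      have h1 : HasDerivAt (fun θ => fderiv ℝ f (p + s • e θ))
          (fderiv ℝ (fderiv ℝ f) (p + s • e θ) (s • Complex.I • e θ)) θ :=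
        (hasFDerivAt_fderiv_of_contDiffOn_two hΩ hf (hq s hs θ)).comp_hasDerivAt θ (hqθ s θ)
      have h2 : HasDerivAt (fun θ => Complex.I • e θ) (Complex.I • Complex.I • e θ) θ :=
        (hed θ).const_smul Complex.I
      refine (h1.clm_apply h2).congr_deriv ?_
      simp [smul_smul, sub_eq_add_neg]
    have hi1 := (slice (hc2 (fun θ => Complex.I • e θ) (by fun_prop)) s hs).intervalIntegrable
      (μ := volume) 0 (2 * Real.pi)
    have hi2 := (slice hc1 s hs).intervalIntegrable (μ := volume) 0 (2 * Real.pi)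
    have hint := intervalIntegral.integral_eq_sub_of_hasDerivAt hderiv
      ((hi1.const_mul s).sub hi2)
    rw [intervalIntegral.integral_sub (hi1.const_mul s) hi2,
      intervalIntegral.integral_const_mul] at hint
    have hper : e (2 * Real.pi) = e 0 := by simp [he]
    rw [hper, sub_self] at hint
    simp only [hφ1]
    linarith
  have hd3 : ∀ s ∈ Ioo (-R) R, HasDerivAt (fun s => s * φ1 s) (1 * φ1 s + s * φ2 s) s :=
    fun s hs => (hasDerivAt_id s).mul (hd2 s hs)
  have hsub : Icc (0 : ℝ) 1 ⊆ Ioo (-R) R := fun s hs => ⟨by linarith [hs.1], by linarith [hs.2]⟩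
  have hint' : interior (Icc (0 : ℝ) 1) ⊆ Icc 0 1 := interior_subset
  have hmono1 : MonotoneOn (fun s => s * φ1 s) (Icc 0 1) := by
    refine monotoneOn_of_deriv_nonneg (convex_Icc 0 1)
      (fun s hs => (hd3 s (hsub hs)).continuousAt.continuousWithinAt)
      (fun s hs => (hd3 s (hsub (hint' hs))).differentiableAt.differentiableWithinAt) ?_
    intro s hs
    have hs' := hsub (hint' hs)
    rw [(hd3 s hs').deriv, one_mul, hparts s hs', ← mul_add, hφ2]
    refine mul_nonneg (hint' hs).1 ?_
    rw [← intervalIntegral.integral_add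
      ((slice (hc2 (fun θ => Complex.I • e θ) (by fun_prop)) s hs').intervalIntegrable _ _)
      ((slice (hc2 e hecont) s hs').intervalIntegrable _ _)]
    refine intervalIntegral.integral_nonneg (by positivity) fun θ _ => ?_
    rw [add_comm]
    exact hQ _ (hq s hs' θ) (e θ)
  have hmono : MonotoneOn φ (Icc 0 1) := by
    refine monotoneOn_of_deriv_nonneg (convex_Icc 0 1)
      (fun s hs => (hd1 s (hsub hs)).continuousAt.continuousWithinAt)
      (fun s hs => (hd1 s (hsub (hint' hs))).differentiableAt.differentiableWithinAt) ?_
    intro s hs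
    rw [(hd1 s (hsub (hint' hs))).deriv]
    rw [interior_Icc] at hs
    have := hmono1 (left_mem_Icc.2 zero_le_one) (Ioo_subset_Icc_self hs) hs.1.le
    simp only [zero_mul] at this
    exact nonneg_of_mul_nonneg_right this hs.1
  have hcircle : ∀ θ : ℝ, f (p + circleMap 0 1 θ • v) = f (p + (1 : ℝ) • e θ) := by
    intro θ
    simp [circleMap, he]
  constructor
  · unfold CircleIntegrable
    simp only [hcircle]
    exact (slice hc0 1 ⟨by linarith, hR⟩).intervalIntegrable _ _
  · rw [Real.circleAverage_def]
    simp only [hcircle]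
    have h01 := hmono (left_mem_Icc.2 zero_le_one) (right_mem_Icc.2 zero_le_one) zero_le_one
    simp only [hφ, zero_smul, add_zero, intervalIntegral.integral_const, sub_zero,
      smul_eq_mul] at h01
    rw [smul_eq_mul, inv_mul_eq_div, le_div_iff₀ (by positivity)]
    linarith

end Levi

theorem plurisubharmonicOn_of_realLevi_nonneg {f : C2 → ℝ} {Ω : Set C2} (hΩ : IsOpen Ω)
    (hf : ContDiffOn ℝ 2 f Ω) (hQ : ∀ p ∈ Ω, ∀ X, 0 ≤ realLevi f p X) :
    PlurisubharmonicOn f Ω :=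
  ⟨hf.continuousOn.upperSemicontinuousOn, fun _ _ h => subMean_of_realLevi_nonneg hΩ hf hQ h⟩

/-! ### Calculus of the Levi form -/

section LeviCalculus

variable {E : Type*} [NormedAddCommGroup E] [NormedSpace ℂ E] [NormedSpace ℝ E]

lemma ContDiffAt.eventually_hasFDerivAt {E F : Type*} [NormedAddCommGroup E] [NormedSpace ℝ E]
    [NormedAddCommGroup F] [NormedSpace ℝ F] {f : E → F}
    {p : E} (hf : ContDiffAt ℝ 2 f p) : ∀ᶠ q in 𝓝 p, HasFDerivAt f (fderiv ℝ f q) q := by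
  filter_upwards [hf.eventually (by simp)] with q hq
  exact (hq.differentiableAt (by norm_num)).hasFDerivAt

lemma ContDiffAt.hasFDerivAt_fderiv {E F : Type*} [NormedAddCommGroup E] [NormedSpace ℝ E]
    [NormedAddCommGroup F] [NormedSpace ℝ F] {f : E → F}
    {p : E} (hf : ContDiffAt ℝ 2 f p) :
    HasFDerivAt (fderiv ℝ f) (fderiv ℝ (fderiv ℝ f) p) p :=
  ((hf.fderiv_right (m := 1) (by norm_num)).differentiableAt (by norm_num)).hasFDerivAt

lemma fderiv_fderiv_comp_real {E : Type*} [NormedAddCommGroup E] [NormedSpace ℝ E] {f : E → ℝ}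
    {p : E} {g g' : ℝ → ℝ} {g'' : ℝ} (hf : ContDiffAt ℝ 2 f p)
    (hg : ∀ᶠ y in 𝓝 (f p), HasDerivAt g (g' y) y) (hg' : HasDerivAt g' g'' (f p)) (X Y : E) :
    fderiv ℝ (fderiv ℝ fun x => g (f x)) p X Y =
      g' (f p) * fderiv ℝ (fderiv ℝ f) p X Y + g'' * (fderiv ℝ f p X * fderiv ℝ f p Y) := by
  have h1 : fderiv ℝ (fun x => g (f x)) =ᶠ[𝓝 p] fun q => g' (f q) • fderiv ℝ f q := by
    filter_upwards [hf.eventually_hasFDerivAt, hf.continuousAt.eventually hg] with q hq hgq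
    exact (hgq.comp_hasFDerivAt q hq).fderiv
  have h2 : HasFDerivAt (fun q => g' (f q)) (g'' • fderiv ℝ f p) p :=
    hg'.comp_hasFDerivAt p hf.eventually_hasFDerivAt.self_of_nhds
  rw [h1.fderiv_eq, (h2.fun_smul hf.hasFDerivAt_fderiv).fderiv]
  simp
  ring

lemma realLevi_comp {f : E → ℝ} {p : E} {g g' : ℝ → ℝ} {g'' : ℝ} (hf : ContDiffAt ℝ 2 f p)
    (hg : ∀ᶠ y in 𝓝 (f p), HasDerivAt g (g' y) y) (hg' : HasDerivAt g' g'' (f p)) (X : E) :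
    realLevi (fun x => g (f x)) p X = g' (f p) * realLevi f p X + g'' * gradSq f p X := by
  simp only [realLevi, gradSq, fderiv_fderiv_comp_real hf hg hg']
  ring

lemma realLevi_add {f g : E → ℝ} {p : E} (hf : ContDiffAt ℝ 2 f p) (hg : ContDiffAt ℝ 2 g p)
    (X : E) : realLevi (fun x => f x + g x) p X = realLevi f p X + realLevi g p X := by
  have h1 : fderiv ℝ (fun x => f x + g x) =ᶠ[𝓝 p] fun q => fderiv ℝ f q + fderiv ℝ g q := by
    filter_upwards [hf.eventually_hasFDerivAt, hg.eventually_hasFDerivAt] with q hq hgq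
    exact (hq.add hgq).fderiv
  simp only [realLevi, h1.fderiv_eq, (hf.hasFDerivAt_fderiv.fun_add hg.hasFDerivAt_fderiv).fderiv,
    add_apply]
  ring

lemma realLevi_const_mul {f : E → ℝ} {p : E} (hf : ContDiffAt ℝ 2 f p) (c : ℝ)
    (X : E) : realLevi (fun x => c * f x) p X = c * realLevi f p X := by
  rw [realLevi_comp (g := fun y => c * y) (g' := fun _ => c) hf
    (Eventually.of_forall fun y => by simpa using (hasDerivAt_id y).const_mul c)
    (hasDerivAt_const _ _)]
  ring

lemma realLevi_finset_sum {ι : Type*} (s : Finset ι) {f : ι → E → ℝ} {p : E}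
    (hf : ∀ i ∈ s, ContDiffAt ℝ 2 (f i) p) (X : E) :
    realLevi (fun x => ∑ i ∈ s, f i x) p X = ∑ i ∈ s, realLevi (f i) p X := by
  classical
  induction s using Finset.induction_on with
  | empty => simp [realLevi]
  | insert a s ha ih =>
    simp only [Finset.sum_insert ha]
    have hs : ∀ i ∈ s, ContDiffAt ℝ 2 (f i) p := fun i hi => hf i (Finset.mem_insert_of_mem hi)
    rw [realLevi_add (hf a (Finset.mem_insert_self a s)) (ContDiffAt.sum hs), ih hs]

lemma realLevi_smul {f : E → ℝ} {p : E} [IsScalarTower ℝ ℂ E] (c : ℝ) (X : E) :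
    realLevi f p (c • X) = c ^ 2 * realLevi f p X := by
  simp only [realLevi, smul_comm Complex.I c X, map_smul, smul_apply,
    smul_eq_mul]
  ring

lemma gradSq_smul {f : E → ℝ} {p : E} [IsScalarTower ℝ ℂ E] (c : ℝ) (X : E) :
    gradSq f p (c • X) = c ^ 2 * gradSq f p X := by
  simp only [gradSq, smul_comm Complex.I c X, map_smul, smul_eq_mul]
  ring

end LeviCalculus

/-! ### Metric regularity and one-sided bounds off a regular zero set -/

/-- A map with surjective strict derivative is metrically regular near a zero. -/
lemma HasStrictFDerivAt.exists_zero_near {E F : Type*} [NormedAddCommGroup E] [NormedSpace ℝ E]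
    [CompleteSpace E] [NormedAddCommGroup F] [NormedSpace ℝ F] [CompleteSpace F]
    {Φ : E → F} {Φ' : E →L[ℝ] F} {a : E} (h : HasStrictFDerivAt Φ Φ' a) (h0 : Φ a = 0)
    (hsurj : Φ'.range = ⊤) :
    ∃ C : ℝ, 0 ≤ C ∧ ∀ᶠ y in 𝓝 a, ∃ z, Φ z = 0 ∧ dist z y ≤ C * ‖Φ y‖ := by
  set N := Φ'.nonlinearRightInverseOfSurjective hsurj with hN
  have hNpos : 0 < N.nnnorm := Φ'.nonlinearRightInverseOfSurjective_nnnorm_pos hsurj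
  have hN2 : 0 < N.nnnorm⁻¹ / 2 := by positivity
  -- With error `N⁻¹ / 2`, the ball of radius `2 N ‖Φ y‖` about `y` covers the ball of radius `(N⁻¹
  -- - N⁻¹ / 2) · 2 N ‖Φ y‖ = ‖Φ y‖` about `Φ y`, which contains `0`.
  obtain ⟨s, hs, happ⟩ := h.approximates_deriv_on_nhds (c := N.nnnorm⁻¹ / 2) (Or.inr hN2)
  obtain ⟨δ, hδ, hball⟩ := Metric.mem_nhds_iff.1 hs
  refine ⟨2 * N.nnnorm, by positivity, ?_⟩
  have hcont : Tendsto (fun y => dist y a + 2 * N.nnnorm * ‖Φ y‖) (𝓝 a) (𝓝 0) := by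
    have hΦ : ContinuousAt Φ a := h.continuousAt
    have : ContinuousAt (fun y => dist y a + 2 * N.nnnorm * ‖Φ y‖) a := by fun_prop
    simpa [ContinuousAt, h0] using this
  filter_upwards [hcont.eventually (gt_mem_nhds hδ)] with y hy
  have hsub : Metric.closedBall y (2 * N.nnnorm * ‖Φ y‖) ⊆ s := by
    intro z hz
    refine hball (lt_of_le_of_lt ?_ hy)
    have := dist_triangle z y a
    rw [Metric.mem_closedBall] at hz
    linarith
  have hsurjOn := happ.surjOn_closedBall_of_nonlinearRightInverse N (by positivity) hsub
  obtain ⟨z, hz, hz0⟩ := hsurjOn (a := 0) (by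
    have hne : (N.nnnorm : ℝ) ≠ 0 := by exact_mod_cast hNpos.ne'
    rw [Metric.mem_closedBall, dist_zero_left]
    apply le_of_eq
    push_cast
    field_simp
    ring)
  exact ⟨z, hz0, hz⟩

/-- A `C¹` function that is nonnegative on the regular zero set of `Φ` is bounded below by a
multiple of `-‖Φ‖`. -/
lemma HasStrictFDerivAt.exists_lower_bound {E F : Type*} [NormedAddCommGroup E] [NormedSpace ℝ E]
    [CompleteSpace E] [NormedAddCommGroup F] [NormedSpace ℝ F] [CompleteSpace F]
    {Φ : E → F} {Φ' : E →L[ℝ] F} {a : E} (h : HasStrictFDerivAt Φ Φ' a) (h0 : Φ a = 0)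
    (hsurj : Φ'.range = ⊤) {G : E → ℝ} (hG : ContDiffAt ℝ 1 G a)
    (hpos : ∀ z, Φ z = 0 → 0 ≤ G z) :
    ∃ C : ℝ, 0 ≤ C ∧ ∀ᶠ y in 𝓝 a, -(C * ‖Φ y‖) ≤ G y := by
  obtain ⟨C, hC, hz⟩ := h.exists_zero_near h0 hsurj
  obtain ⟨K, s, hs, hK⟩ := hG.exists_lipschitzOnWith
  obtain ⟨δ, hδ, hball⟩ := Metric.mem_nhds_iff.1 hs
  have hcont : Tendsto (fun y => dist y a + C * ‖Φ y‖) (𝓝 a) (𝓝 0) := by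
    have hΦ : ContinuousAt Φ a := h.continuousAt
    have : ContinuousAt (fun y => dist y a + C * ‖Φ y‖) a := by fun_prop
    simpa [ContinuousAt, h0] using this
  refine ⟨K * C, by positivity, ?_⟩
  filter_upwards [hz, hcont.eventually (gt_mem_nhds hδ), hs] with y ⟨z, hz0, hzy⟩ hy hys
  have hzs : z ∈ s := hball (lt_of_le_of_lt (by linarith [dist_triangle z y a]) hy)
  have h1 := hK.dist_le_mul z hzs y hys
  rw [Real.dist_eq] at h1
  have h2 := (abs_le.1 h1).2
  have h3 := hpos z hz0
  have h4 : (K : ℝ) * dist z y ≤ K * (C * ‖Φ y‖) := by gcongr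
  linarith

/-! ### Smoothness of the forms, and their relation to Wirtinger derivatives -/

lemma two_le_infty : (2 : WithTop ℕ∞) ≤ ∞ := by
  exact WithTop.coe_le_coe.2 (le_top : (2 : ℕ∞) ≤ ⊤)

lemma contDiff_fderiv_apply_apply {f : C2 → ℝ} (hf : ContDiff ℝ ∞ f) {n : ℕ∞}
    {X Y : C2 × C2 → C2} (hX : ContDiff ℝ n X) (hY : ContDiff ℝ n Y) :
    ContDiff ℝ n fun y : C2 × C2 => fderiv ℝ (fderiv ℝ f) y.1 (X y) (Y y) := by
  have h2 : ContDiff ℝ n (fderiv ℝ (fderiv ℝ f)) :=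
    ((hf.fderiv_right (m := ∞) (by simp)).fderiv_right (m := ∞) (by simp)).of_le
      (by exact_mod_cast le_top)
  exact ((h2.comp contDiff_fst).clm_apply hX).clm_apply hY

lemma contDiff_const_smul_snd (c : ℂ) {n : WithTop ℕ∞} :
    ContDiff ℝ n fun y : C2 × C2 => c • y.2 :=
  contDiff_snd.const_smul c

lemma contDiff_realLevi {f : C2 → ℝ} (hf : ContDiff ℝ ∞ f) {n : ℕ∞} :
    ContDiff ℝ n fun y : C2 × C2 => realLevi f y.1 y.2 :=
  (contDiff_fderiv_apply_apply hf contDiff_snd contDiff_snd).add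
    (contDiff_fderiv_apply_apply hf (contDiff_const_smul_snd _) (contDiff_const_smul_snd _))

lemma contDiff_gradSq {f : C2 → ℝ} (hf : ContDiff ℝ ∞ f) {n : ℕ∞} :
    ContDiff ℝ n fun y : C2 × C2 => gradSq f y.1 y.2 := by
  have h1 : ContDiff ℝ n (fun y : C2 × C2 => fderiv ℝ f y.1) :=
    ((hf.fderiv_right (m := ∞) (by simp)).of_le (by exact_mod_cast le_top)).comp contDiff_fst
  exact ((h1.clm_apply contDiff_snd).pow 2).add
    ((h1.clm_apply (contDiff_const_smul_snd _)).pow 2)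

lemma fderiv_ofReal_comp {f : C2 → ℝ} {p : C2} (hf : DifferentiableAt ℝ f p) (v : C2) :
    fderiv ℝ (fun x => (f x : ℂ)) p v = (fderiv ℝ f p v : ℂ) := by
  have : HasFDerivAt (fun x => (f x : ℂ)) (Complex.ofRealCLM.comp (fderiv ℝ f p)) p :=
    Complex.ofRealCLM.hasFDerivAt.comp p hf.hasFDerivAt
  rw [this.fderiv]
  rfl

lemma wirtinger_wirtingerBar {f : C2 → ℝ} (hf : ContDiff ℝ ∞ f) (j k : Fin 2) (p : C2) :
    wirtinger j (fun q => wirtingerBar k (fun x => (f x : ℂ)) q) p =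
      (1 / 4 : ℂ) *
        ((fderiv ℝ (fderiv ℝ f) p (EuclideanSpace.single j 1) (EuclideanSpace.single k 1)
          + fderiv ℝ (fderiv ℝ f) p (EuclideanSpace.single j Complex.I)
              (EuclideanSpace.single k Complex.I) : ℝ)
        + Complex.I *
          (fderiv ℝ (fderiv ℝ f) p (EuclideanSpace.single j 1) (EuclideanSpace.single k Complex.I)
          - fderiv ℝ (fderiv ℝ f) p (EuclideanSpace.single j Complex.I)
              (EuclideanSpace.single k 1) : ℝ)) := by
  have hd : Differentiable ℝ f := hf.differentiable (by simp)
  have h2 : HasFDerivAt (fderiv ℝ f) (fderiv ℝ (fderiv ℝ f) p) p :=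
    (hf.contDiffAt.of_le two_le_infty).hasFDerivAt_fderiv
  have hv : ∀ v : C2, HasFDerivAt (fun q => fderiv ℝ f q v)
      ((fderiv ℝ (fderiv ℝ f) p).flip v) p := by
    intro v
    simpa using h2.clm_apply (hasFDerivAt_const v p)
  have hvc : ∀ v : C2, HasFDerivAt (fun q => (fderiv ℝ f q v : ℂ))
      (Complex.ofRealCLM.comp ((fderiv ℝ (fderiv ℝ f) p).flip v)) p := fun v =>
    Complex.ofRealCLM.hasFDerivAt.comp p (hv v)
  have hw := ((hvc (EuclideanSpace.single k 1)).add
    ((hvc (EuclideanSpace.single k Complex.I)).const_mul Complex.I)).const_mul (1 / 2 : ℂ)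
  have hw' := hw.congr_of_eventuallyEq (f₁ := fun q => wirtingerBar k (fun x => (f x : ℂ)) q)
    (Eventually.of_forall fun q => by
      simp only [wirtingerBar, fderiv_ofReal_comp (hd q)]
      rfl)
  rw [wirtinger, hw'.fderiv]
  simp only [smul_apply, add_apply, ContinuousLinearMap.comp_apply,
    ContinuousLinearMap.flip_apply, Complex.ofRealCLM_apply, smul_eq_mul]
  push_cast
  linear_combination (1 / 4 : ℂ) * (-(fderiv ℝ (fderiv ℝ f) p
    (EuclideanSpace.single j Complex.I) (EuclideanSpace.single k Complex.I) : ℂ)) * Complex.I_sq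

lemma eq_sum_single (X : C2) :
    X = (X 0).re • EuclideanSpace.single 0 (1 : ℂ) + (X 0).im • EuclideanSpace.single 0 Complex.I
      + (X 1).re • EuclideanSpace.single 1 (1 : ℂ)
      + (X 1).im • EuclideanSpace.single 1 Complex.I := by
  ext i
  fin_cases i <;> simp [Complex.re_add_im]

lemma I_smul_eq_sum_single (X : C2) :
    Complex.I • X = -(X 0).im • EuclideanSpace.single 0 (1 : ℂ)
      + (X 0).re • EuclideanSpace.single 0 Complex.I
      + -(X 1).im • EuclideanSpace.single 1 (1 : ℂ)
      + (X 1).re • EuclideanSpace.single 1 Complex.I := by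
  rw [eq_sum_single (Complex.I • X)]
  simp

lemma fderiv_fderiv_symm {f : C2 → ℝ} (hf : ContDiff ℝ ∞ f) (p X Y : C2) :
    fderiv ℝ (fderiv ℝ f) p X Y = fderiv ℝ (fderiv ℝ f) p Y X := by
  have : IsSymmSndFDerivAt ℝ f p :=
    (hf.contDiffAt (x := p)).isSymmSndFDerivAt (by simpa using two_le_infty)
  exact this X Y

/-- Expand both sides in the real basis; symmetry of the second derivative cancels the imaginary
part. -/
lemma complexHessian_self {f : C2 → ℝ} (hf : ContDiff ℝ ∞ f) (X p : C2) :
    complexHessian f X X p = ((1 / 4 * realLevi f p X : ℝ) : ℂ) := by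
  have hs := fderiv_fderiv_symm hf p
  have h1 : fderiv ℝ (fderiv ℝ f) p X X = fderiv ℝ (fderiv ℝ f) p _ _ :=
    congrArg₂ (fun Y Z => fderiv ℝ (fderiv ℝ f) p Y Z) (eq_sum_single X) (eq_sum_single X)
  have h2 : fderiv ℝ (fderiv ℝ f) p (Complex.I • X) (Complex.I • X) =
      fderiv ℝ (fderiv ℝ f) p _ _ :=
    congrArg₂ (fun Y Z => fderiv ℝ (fderiv ℝ f) p Y Z) (I_smul_eq_sum_single X)
      (I_smul_eq_sum_single X)
  simp only [complexHessian, Fin.sum_univ_two, wirtinger_wirtingerBar hf]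
  rw [realLevi, h1, h2]
  simp only [map_add, map_smul, add_apply, smul_apply, smul_eq_mul,
    hs (EuclideanSpace.single 0 Complex.I) (EuclideanSpace.single 0 1),
    hs (EuclideanSpace.single 1 1) (EuclideanSpace.single 0 1),
    hs (EuclideanSpace.single 1 Complex.I) (EuclideanSpace.single 0 1),
    hs (EuclideanSpace.single 1 1) (EuclideanSpace.single 0 Complex.I),
    hs (EuclideanSpace.single 1 Complex.I) (EuclideanSpace.single 0 Complex.I),
    hs (EuclideanSpace.single 1 Complex.I) (EuclideanSpace.single 1 1)]
  apply Complex.ext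
  · simp
    ring
  · simp
    ring

lemma realLevi_complex_smul (f : C2 → ℝ) (p X : C2) (a : ℂ) :
    realLevi f p (a • X) = ‖a‖ ^ 2 * realLevi f p X := by
  have h1 : a • X = a.re • X + a.im • (Complex.I • X) := by
    ext i
    apply Complex.ext <;> simp
    ring
  have h2 : Complex.I • a • X = a.re • (Complex.I • X) + -a.im • X := by
    ext i
    apply Complex.ext <;> simp
    · ring
    · ring
  rw [Complex.sq_norm, Complex.normSq_apply]
  simp only [realLevi, h2]
  rw [h1]
  simp only [map_add, map_smul, add_apply, smul_apply, smul_eq_mul]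
  ring

lemma leviForm_eq {ρ : C2 → ℝ} (hρ : ContDiff ℝ ∞ ρ) (p : C2) :
    leviForm ρ p = ((1 / 4 * realLevi ρ p (tangentialField ρ p) : ℝ) : ℂ) :=
  complexHessian_self hρ _ p

lemma wirtinger_ofReal {f : C2 → ℝ} {p : C2} (hf : DifferentiableAt ℝ f p) (j : Fin 2) :
    wirtinger j (fun x => (f x : ℂ)) p =
      (1 / 2 : ℂ) * (fderiv ℝ f p (EuclideanSpace.single j 1)
        - Complex.I * fderiv ℝ f p (EuclideanSpace.single j Complex.I)) := by
  rw [wirtinger, fderiv_ofReal_comp hf, fderiv_ofReal_comp hf]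

lemma wirtinger_sum_eq {f : C2 → ℝ} {p : C2} (hf : DifferentiableAt ℝ f p) (X : C2) :
    wirtinger 0 (fun x => (f x : ℂ)) p * X 0 + wirtinger 1 (fun x => (f x : ℂ)) p * X 1 =
      (1 / 2 : ℂ) * (fderiv ℝ f p X - Complex.I * fderiv ℝ f p (Complex.I • X)) := by
  have h1 : fderiv ℝ f p X = fderiv ℝ f p _ := congrArg (fderiv ℝ f p) (eq_sum_single X)
  have h2 : fderiv ℝ f p (Complex.I • X) = fderiv ℝ f p _ :=
    congrArg (fderiv ℝ f p) (I_smul_eq_sum_single X)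
  rw [wirtinger_ofReal hf, wirtinger_ofReal hf, h1, h2]
  simp only [map_add, map_smul, smul_eq_mul]
  apply Complex.ext
  · simp
    ring
  · simp
    ring

lemma wirtinger_normSq_pos {f : C2 → ℝ} {p : C2} (hf : fderiv ℝ f p ≠ 0) :
    0 < ‖wirtinger 0 (fun x => (f x : ℂ)) p‖ ^ 2 + ‖wirtinger 1 (fun x => (f x : ℂ)) p‖ ^ 2 := by
  by_contra hcon
  have h0 : ‖wirtinger 0 (fun x => (f x : ℂ)) p‖ ^ 2 = 0 := by
    nlinarith [sq_nonneg ‖wirtinger 0 (fun x => (f x : ℂ)) p‖,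
      sq_nonneg ‖wirtinger 1 (fun x => (f x : ℂ)) p‖]
  have h1 : ‖wirtinger 1 (fun x => (f x : ℂ)) p‖ ^ 2 = 0 := by
    nlinarith [sq_nonneg ‖wirtinger 0 (fun x => (f x : ℂ)) p‖,
      sq_nonneg ‖wirtinger 1 (fun x => (f x : ℂ)) p‖]
  have hd : DifferentiableAt ℝ f p := by
    by_contra h
    exact hf (fderiv_zero_of_not_differentiableAt h)
  refine hf (ContinuousLinearMap.ext fun X => ?_)
  have h := wirtinger_sum_eq hd X
  rw [norm_eq_zero.1 (pow_eq_zero_iff two_ne_zero |>.1 h0),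
    norm_eq_zero.1 (pow_eq_zero_iff two_ne_zero |>.1 h1)] at h
  have := congrArg Complex.re h
  simpa using this

/-- In dimension two the kernel of the nonzero form `∂ρ` is a single complex line. The equation `ρ_z
X₀ + ρ_w X₁ = 0` is solved by dividing by whichever coefficient is nonzero. -/
lemma exists_eq_smul_tangentialField {ρ : C2 → ℝ} {p X : C2} (hρ : fderiv ℝ ρ p ≠ 0)
    (hX : gradSq ρ p X = 0) : ∃ a : ℂ, X = a • tangentialField ρ p := by
  have hd : DifferentiableAt ℝ ρ p := by
    by_contra h
    exact hρ (fderiv_zero_of_not_differentiableAt h)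
  have hpos := wirtinger_normSq_pos hρ
  have hsum := wirtinger_sum_eq hd X
  have hX1 : fderiv ℝ ρ p X = 0 := by
    unfold gradSq at hX
    nlinarith [sq_nonneg (fderiv ℝ ρ p X),
      sq_nonneg (fderiv ℝ ρ p (Complex.I • X))]
  have hX2 : fderiv ℝ ρ p (Complex.I • X) = 0 := by
    unfold gradSq at hX
    nlinarith [sq_nonneg (fderiv ℝ ρ p X),
      sq_nonneg (fderiv ℝ ρ p (Complex.I • X))]
  rw [hX1, hX2] at hsum
  simp only [Complex.ofReal_zero, mul_zero, sub_zero] at hsum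
  unfold tangentialField
  set ρz := wirtinger 0 (fun x => (ρ x : ℂ)) p
  set ρw := wirtinger 1 (fun x => (ρ x : ℂ)) p
  have hc0 : (Real.sqrt (‖ρz‖ ^ 2 + ‖ρw‖ ^ 2) : ℂ) ≠ 0 := by
    exact_mod_cast (Real.sqrt_pos.2 hpos).ne'
  change ∃ a : ℂ, X = a • ((Real.sqrt (‖ρz‖ ^ 2 + ‖ρw‖ ^ 2))⁻¹ • !₂[ρw, -ρz])
  generalize Real.sqrt (‖ρz‖ ^ 2 + ‖ρw‖ ^ 2) = c at hc0 ⊢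
  by_cases hw : ρw = 0
  · have hz : ρz ≠ 0 := by
      rintro hz
      simp [hw, hz] at hpos
    have hX0 : X 0 = 0 := by simpa [hw, hz] using hsum
    refine ⟨-(X 1 * c / ρz), ?_⟩
    ext i
    fin_cases i
    · simp [hw, hX0]
    · simp
      field_simp
  · refine ⟨X 0 * c / ρw, ?_⟩
    ext i
    fin_cases i
    · simp
      field_simp
    · simp
      field_simp
      linear_combination hsum

lemma continuousOn_tangentialField {Ω : Set C2} {ρ : C2 → ℝ} (hρ : IsDefiningFunction Ω ρ) :
    ContinuousOn (tangentialField ρ) (frontier Ω) := by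
  have hd : Differentiable ℝ ρ := hρ.smooth.differentiable (by simp)
  have hc : ∀ j, Continuous (wirtinger j (fun x => (ρ x : ℂ))) := by
    intro j
    have hρ' : Continuous (fderiv ℝ ρ) := hρ.smooth.continuous_fderiv (by simp)
    have : wirtinger j (fun x => (ρ x : ℂ)) = fun p =>
      (1 / 2 : ℂ) * (fderiv ℝ ρ p (EuclideanSpace.single j 1)
        - Complex.I * fderiv ℝ ρ p (EuclideanSpace.single j Complex.I)) :=
      funext fun p => wirtinger_ofReal (hd p) j
    rw [this]
    fun_prop
  have h0 := hc 0
  have h1 := hc 1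
  unfold tangentialField
  refine ContinuousOn.smul (ContinuousOn.inv₀ (by fun_prop) fun p hp =>
    (Real.sqrt_pos.2 (wirtinger_normSq_pos (hρ.fderiv_ne_zero p hp))).ne') ?_
  apply Continuous.continuousOn
  refine (PiLp.continuous_toLp 2 _).comp (continuous_pi fun i => ?_)
  fin_cases i
  · exact h1
  · exact h0.neg

/-! ### The Levi form on the boundary, and compactness of the Levi-flat set -/

section Boundary

variable {Ω : Set C2} {ρ : C2 → ℝ}

lemma realLevi_nonneg_of_isLeviPseudoconvex (hρ : IsDefiningFunction Ω ρ)
    (hpsc : IsLeviPseudoconvex Ω ρ) {q X : C2} (hq : q ∈ frontier Ω) (hX : gradSq ρ q X = 0) :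
    0 ≤ realLevi ρ q X := by
  obtain ⟨a, rfl⟩ := exists_eq_smul_tangentialField (hρ.fderiv_ne_zero q hq) hX
  have h := hpsc q hq
  rw [leviForm_eq hρ.smooth, Complex.ofReal_re] at h
  rw [realLevi_complex_smul]
  have : 0 ≤ realLevi ρ q (tangentialField ρ q) := by linarith
  positivity

lemma mem_leviFlatSet_iff (hρ : IsDefiningFunction Ω ρ) {q : C2} :
    q ∈ leviFlatSet Ω ρ ↔ q ∈ frontier Ω ∧ realLevi ρ q (tangentialField ρ q) = 0 := by
  simp only [leviFlatSet, mem_ofPred_eq, leviForm_eq hρ.smooth, Complex.ofReal_eq_zero]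
  simp

lemma realLevi_pos_of_notMem_leviFlatSet (hρ : IsDefiningFunction Ω ρ)
    (hpsc : IsLeviPseudoconvex Ω ρ) {q X : C2} (hq : q ∈ frontier Ω) (hqL : q ∉ leviFlatSet Ω ρ)
    (hX : gradSq ρ q X = 0) (hX0 : X ≠ 0) : 0 < realLevi ρ q X := by
  refine (realLevi_nonneg_of_isLeviPseudoconvex hρ hpsc hq hX).lt_of_ne' ?_
  obtain ⟨a, rfl⟩ := exists_eq_smul_tangentialField (hρ.fderiv_ne_zero q hq) hX
  have ha : a ≠ 0 := by
    rintro rfl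
    simp at hX0
  rw [realLevi_complex_smul]
  refine mul_ne_zero (by positivity) fun h => hqL ?_
  exact (mem_leviFlatSet_iff hρ).2 ⟨hq, h⟩

lemma isCompact_frontier_of_isBounded {Ω : Set C2} (hΩ : Bornology.IsBounded Ω) :
    IsCompact (frontier Ω) :=
  Metric.isCompact_of_isClosed_isBounded isClosed_frontier
    (hΩ.closure.subset frontier_subset_closure)

lemma isCompact_leviFlatSet (hρ : IsDefiningFunction Ω ρ) (hΩ : Bornology.IsBounded Ω) :
    IsCompact (leviFlatSet Ω ρ) := by
  have hset : leviFlatSet Ω ρ =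
      frontier Ω ∩ (fun q => realLevi ρ q (tangentialField ρ q)) ⁻¹' {0} := by
    ext q
    exact mem_leviFlatSet_iff hρ
  have hcont : ContinuousOn (fun q => realLevi ρ q (tangentialField ρ q)) (frontier Ω) :=
    (contDiff_realLevi hρ.smooth (n := 0)).continuous.comp_continuousOn
      (continuousOn_id.prodMk (continuousOn_tangentialField hρ))
  refine (isCompact_frontier_of_isBounded hΩ).of_isClosed_subset ?_ (hset ▸ inter_subset_left)
  rw [hset]
  exact hcont.preimage_isClosed_of_isClosed isClosed_frontier isClosed_singleton

lemma finite_leviFlatSet_of_isolated (hρ : IsDefiningFunction Ω ρ) (hΩ : Bornology.IsBounded Ω)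
    (h : ∀ p ∈ leviFlatSet Ω ρ, IsIsolatedPt (leviFlatSet Ω ρ) p) : (leviFlatSet Ω ρ).Finite := by
  by_contra hinf
  obtain ⟨x, hx, hacc⟩ := Set.Infinite.exists_accPt_of_subset_isCompact hinf
    (isCompact_leviFlatSet hρ hΩ) subset_rfl
  exact (h x hx).2 hacc

end Boundary

/-! ### Estimates near the boundary -/

section BoundaryEstimates

variable {Ω : Set C2} {ρ : C2 → ℝ}

/-- The complex-linear form `∂f` is nonzero, hence onto `ℂ`; the preimage is found in the complex
line of a vector `V` with `df(V) ≠ 0`. -/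
lemma exists_fderiv_eq_and_fderiv_I_smul_eq {f : C2 → ℝ} {p : C2} (hf : fderiv ℝ f p ≠ 0)
    (a b : ℝ) : ∃ Y : C2, fderiv ℝ f p Y = a ∧ fderiv ℝ f p (Complex.I • Y) = b := by
  obtain ⟨V, hV⟩ : ∃ V, fderiv ℝ f p V ≠ 0 := by
    by_contra! h
    exact hf (ContinuousLinearMap.ext h)
  set u := fderiv ℝ f p V with hu
  set w := fderiv ℝ f p (Complex.I • V) with hw
  have hpos : u ^ 2 + w ^ 2 ≠ 0 := by positivity
  have hII : Complex.I • Complex.I • V = -V := by simp [smul_smul]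
  refine ⟨((a * u + b * w) / (u ^ 2 + w ^ 2)) • V +
    ((a * w - b * u) / (u ^ 2 + w ^ 2)) • (Complex.I • V), ?_, ?_⟩
  · simp only [map_add, map_smul, smul_eq_mul, ← hu, ← hw]
    field_simp
    ring
  · rw [smul_add, smul_comm Complex.I _ V, smul_comm Complex.I _ (Complex.I • V), hII]
    simp only [map_add, map_smul, map_neg, smul_eq_mul, ← hu, ← hw]
    field_simp
    ring

/-- The defining map of the bundle of complex tangent vectors to the boundary. -/
def complexTangentMap (ρ : C2 → ℝ) (y : C2 × C2) : ℝ × ℝ × ℝ :=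
  (ρ y.1, fderiv ℝ ρ y.1 y.2, fderiv ℝ ρ y.1 (Complex.I • y.2))

lemma exists_hasStrictFDerivAt_complexTangentMap (hρ : ContDiff ℝ ∞ ρ) {q : C2}
    (hq : fderiv ℝ ρ q ≠ 0) (X : C2) : ∃ Φ' : C2 × C2 →L[ℝ] ℝ × ℝ × ℝ,
      HasStrictFDerivAt (complexTangentMap ρ) Φ' (q, X) ∧ Φ'.range = ⊤ := by
  have h0 : HasStrictFDerivAt (fun y : C2 × C2 => ρ y.1) _ (q, X) :=
    (hρ.contDiffAt.hasStrictFDerivAt (by simp)).comp (q, X) hasStrictFDerivAt_fst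
  have h1 : HasStrictFDerivAt (fun y : C2 × C2 => fderiv ℝ ρ y.1) _ (q, X) :=
    ((hρ.fderiv_right (m := ∞) (by simp)).contDiffAt.hasStrictFDerivAt (by simp)).comp
      (q, X) hasStrictFDerivAt_fst
  have h2 := h1.clm_apply (hasStrictFDerivAt_snd (p := (q, X)))
  have hI : HasStrictFDerivAt (fun y : C2 × C2 => Complex.I • y.2)
      (Complex.I • ContinuousLinearMap.snd ℝ C2 C2) (q, X) :=
    hasStrictFDerivAt_snd.const_smul Complex.I
  have h3 := h1.clm_apply hI
  refine ⟨_, h0.prodMk (h2.prodMk h3), ?_⟩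
  rw [LinearMap.range_eq_top]
  rintro ⟨a, b, c⟩
  -- The derivative is block triangular: the base direction `h` fixes the first component, then `Y`
  -- corrects the other two, including the second-derivative terms that `h` produces.
  obtain ⟨h, hh, -⟩ := exists_fderiv_eq_and_fderiv_I_smul_eq hq a 0
  obtain ⟨Y, hY1, hY2⟩ := exists_fderiv_eq_and_fderiv_I_smul_eq hq
    (b - fderiv ℝ (fderiv ℝ ρ) q h X) (c - fderiv ℝ (fderiv ℝ ρ) q h (Complex.I • X))
  refine ⟨(h, Y), ?_⟩
  simp [hh, hY1, hY2]

/-- Pseudoconvexity makes the Levi form nonnegative on the zero set of `complexTangentMap ρ`, which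
is regular. The negative part is therefore controlled linearly by the norm of that map. -/
lemma exists_neg_le_realLevi (hρ : IsDefiningFunction Ω ρ) (hpsc : IsLeviPseudoconvex Ω ρ)
    {q X : C2} (hq : q ∈ frontier Ω) (hX : gradSq ρ q X = 0) :
    ∃ C : ℝ, 0 ≤ C ∧ ∀ᶠ y : C2 × C2 in 𝓝 (q, X),
      -(C * (|ρ y.1| + Real.sqrt (gradSq ρ y.1 y.2))) ≤ realLevi ρ y.1 y.2 := by
  have hzero : ∀ y : C2 × C2, complexTangentMap ρ y = 0 ↔ ρ y.1 = 0 ∧ gradSq ρ y.1 y.2 = 0 := by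
    intro y
    simp only [complexTangentMap, gradSq, Prod.mk_eq_zero]
    refine and_congr Iff.rfl ⟨fun h => by simp [h.1, h.2], fun h => ?_⟩
    constructor <;> nlinarith [sq_nonneg (fderiv ℝ ρ y.1 y.2),
      sq_nonneg (fderiv ℝ ρ y.1 (Complex.I • y.2))]
  have hmem : ∀ p, ρ p = 0 ↔ p ∈ frontier Ω := fun p => by rw [hρ.frontier_eq]; rfl
  obtain ⟨Φ', hΦ, hsurj⟩ :=
    exists_hasStrictFDerivAt_complexTangentMap hρ.smooth (hρ.fderiv_ne_zero q hq) X
  obtain ⟨C, hC, hev⟩ := hΦ.exists_lower_bound ((hzero _).2 ⟨(hmem q).2 hq, hX⟩) hsurj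
    (G := fun y => realLevi ρ y.1 y.2) (contDiff_realLevi hρ.smooth (n := 1)).contDiffAt
    (fun z hz => realLevi_nonneg_of_isLeviPseudoconvex hρ hpsc ((hmem _).1 ((hzero z).1 hz).1)
      ((hzero z).1 hz).2)
  refine ⟨C, hC, ?_⟩
  filter_upwards [hev] with y hy
  refine le_trans (neg_le_neg (mul_le_mul_of_nonneg_left ?_ hC)) hy
  have hle : ∀ a b : ℝ, |a| ≤ |ρ y.1| + Real.sqrt (a ^ 2 + b) ∨ b < 0 := by
    intro a b
    by_cases hb : b < 0
    · exact Or.inr hb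
    · left
      have := Real.abs_le_sqrt (show a ^ 2 ≤ a ^ 2 + b by linarith)
      linarith [abs_nonneg (ρ y.1)]
  rw [complexTangentMap, Prod.norm_def, Prod.norm_def]
  refine max_le ?_ (max_le ?_ ?_)
  · simp
  · exact (hle _ _).resolve_right (sq_nonneg _).not_gt
  · have := (hle (fderiv ℝ ρ y.1 (Complex.I • y.2)) _).resolve_right
      (sq_nonneg (fderiv ℝ ρ y.1 y.2)).not_gt
    rwa [add_comm (_ ^ 2)] at this

lemma eventually_pos_of_gradSq_pos (hρ : IsDefiningFunction Ω ρ) {σ : ℝ} (hσ : 0 < σ)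
    {q X : C2} (hq : q ∈ frontier Ω) (hX : 0 < gradSq ρ q X) :
    ∀ᶠ y : C2 × C2 in 𝓝 (q, X),
      0 < -ρ y.1 * realLevi ρ y.1 y.2 + σ * gradSq ρ y.1 y.2 := by
  have hcont : Continuous fun y : C2 × C2 =>
      -ρ y.1 * realLevi ρ y.1 y.2 + σ * gradSq ρ y.1 y.2 := by
    have h1 := (contDiff_realLevi hρ.smooth (n := 0)).continuous
    have h2 := (contDiff_gradSq hρ.smooth (n := 0)).continuous
    have h3 := hρ.smooth.continuous
    fun_prop
  refine hcont.continuousAt.eventually (lt_mem_nhds ?_)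
  rw [hρ.frontier_eq] at hq
  simp only [show ρ q = 0 from hq, neg_zero, zero_mul, zero_add]
  positivity

/-- In null directions of `∂ρ`, put `s = -ρ` and `m = |∂ρ(X)|`: the loss is `C s² + C s m`, and `C s
m ≤ σ m² + C² s² / (4 σ)`. In other directions the term in `σ` dominates. -/
lemma exists_eventually_nonneg (hρ : IsDefiningFunction Ω ρ) (hpsc : IsLeviPseudoconvex Ω ρ)
    {σ : ℝ} (hσ : 0 < σ) {q : C2} (hq : q ∈ frontier Ω) (X : C2) :
    ∃ M : ℝ, 0 ≤ M ∧ ∀ᶠ y : C2 × C2 in 𝓝 (q, X), ρ y.1 < 0 →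
      0 ≤ -ρ y.1 * realLevi ρ y.1 y.2 + σ * gradSq ρ y.1 y.2 + ρ y.1 ^ 2 * M := by
  rcases (gradSq_nonneg ρ q X).eq_or_lt with hX | hX
  · obtain ⟨C, hC, hev⟩ := exists_neg_le_realLevi hρ hpsc hq hX.symm
    refine ⟨C + C ^ 2 / (4 * σ), by positivity, ?_⟩
    filter_upwards [hev] with y hy hneg
    rw [abs_of_neg hneg] at hy
    have hm := Real.sq_sqrt (gradSq_nonneg ρ y.1 y.2)
    set m := Real.sqrt (gradSq ρ y.1 y.2)
    rw [← hm]
    set s := -ρ y.1 with hs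
    have hs' : ρ y.1 = -s := by simp [hs]
    have hspos : 0 < s := by linarith
    have h1 : s * -(C * (s + m)) ≤ s * realLevi ρ y.1 y.2 := by gcongr
    have h2 : σ * m ^ 2 - C * s * m + C ^ 2 / (4 * σ) * s ^ 2 =
        σ * (m - C * s / (2 * σ)) ^ 2 := by
      field_simp
      ring
    have h3 : 0 ≤ σ * (m - C * s / (2 * σ)) ^ 2 := by positivity
    rw [hs']
    linarith
  · refine ⟨0, le_rfl, ?_⟩
    filter_upwards [eventually_pos_of_gradSq_pos hρ hσ hq hX] with y hy _
    linarith

/-- The estimate is monotone in `M`, so compactness of the unit sphere bundle over the boundary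
yields one constant. -/
lemma exists_uniform_eventually_nonneg (hbdd : Bornology.IsBounded Ω)
    (hρ : IsDefiningFunction Ω ρ) (hpsc : IsLeviPseudoconvex Ω ρ) {σ : ℝ} (hσ : 0 < σ) :
    ∃ M : ℝ, 0 ≤ M ∧ ∀ q ∈ frontier Ω, ∀ X : C2, ‖X‖ = 1 → ∀ᶠ y : C2 × C2 in 𝓝 (q, X),
      ρ y.1 < 0 →
      0 ≤ -ρ y.1 * realLevi ρ y.1 y.2 + σ * gradSq ρ y.1 y.2 + ρ y.1 ^ 2 * M := by
  set P : ℝ → C2 × C2 → Prop := fun M y => ρ y.1 < 0 →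
      0 ≤ -ρ y.1 * realLevi ρ y.1 y.2 + σ * gradSq ρ y.1 y.2 + ρ y.1 ^ 2 * M with hP
  have hPmono : ∀ {M N : ℝ}, M ≤ N → ∀ y, P M y → P N y := by
    intro M N hMN y hy hneg
    refine (hy hneg).trans ?_
    gcongr
  have hK : IsCompact (frontier Ω ×ˢ Metric.sphere (0 : C2) 1) :=
    (isCompact_frontier_of_isBounded hbdd).prod (isCompact_sphere _ _)
  suffices h : ∃ M : ℝ, 0 ≤ M ∧
      ∀ x ∈ frontier Ω ×ˢ Metric.sphere (0 : C2) 1, ∀ᶠ y in 𝓝 x, P M y by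
    obtain ⟨M, hM, h⟩ := h
    exact ⟨M, hM, fun q hq X hX => h (q, X) ⟨hq, by simpa using hX⟩⟩
  refine hK.induction_on (p := fun s => ∃ M : ℝ, 0 ≤ M ∧ ∀ x ∈ s, ∀ᶠ y in 𝓝 x, P M y)
    ⟨0, le_rfl, by simp⟩ ?_ ?_ ?_
  · rintro s t hst ⟨M, hM, h⟩
    exact ⟨M, hM, fun x hx => h x (hst hx)⟩
  · rintro s t ⟨M, hM, h⟩ ⟨N, hN, h'⟩
    refine ⟨max M N, le_max_of_le_left hM, ?_⟩
    rintro x (hx | hx)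
    · exact (h x hx).mono (hPmono (le_max_left _ _))
    · exact (h' x hx).mono (hPmono (le_max_right _ _))
  · rintro ⟨q, X⟩ ⟨hq, -⟩
    obtain ⟨M, hM, h⟩ := exists_eventually_nonneg hρ hpsc hσ hq X
    exact ⟨{x | ∀ᶠ y in 𝓝 x, P M y}, mem_nhdsWithin_of_mem_nhds (eventually_eventually_nhds.2 h),
      M, hM, fun x hx => hx⟩

/-- Off a neighbourhood of the boundary, `ρ` has a negative maximum on the compact rest of `closure
Ω`. -/
lemma exists_pos_forall_of_eventually_nhdsSet_frontier (hbdd : Bornology.IsBounded Ω)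
    (hρ : IsDefiningFunction Ω ρ) {P : C2 → Prop} (hP : ∀ᶠ p in 𝓝ˢ (frontier Ω), P p) :
    ∃ s : ℝ, 0 < s ∧ ∀ p, ρ p < 0 → -s < ρ p → P p := by
  obtain ⟨U, hU, hsub, hUP⟩ := eventually_nhdsSet_iff_exists.1 hP
  have hcl : ∀ p ∈ closure Ω \ U, ρ p < 0 := by
    intro p hp
    have hle : ρ p ≤ 0 := by
      have : closure Ω ⊆ {p | ρ p ≤ 0} := closure_minimal
        (fun x hx => by rw [hρ.eq_neg] at hx; exact (show ρ x < 0 from hx).le)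
        (isClosed_le hρ.smooth.continuous continuous_const)
      exact this hp.1
    refine hle.lt_of_ne fun h0 => hp.2 (hsub ?_)
    rw [hρ.frontier_eq]
    exact h0
  have hcomp : IsCompact (closure Ω \ U) :=
    (Metric.isCompact_of_isClosed_isBounded isClosed_closure hbdd.closure).diff hU
  have hΩ : ∀ p, ρ p < 0 → p ∈ closure Ω := fun p hp =>
    subset_closure (by rw [hρ.eq_neg]; exact hp)
  rcases (closure Ω \ U).eq_empty_or_nonempty with hemp | hne
  · refine ⟨1, one_pos, fun p hp _ => hUP p ?_⟩
    by_contra hpU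
    exact (hemp ▸ (⟨hΩ p hp, hpU⟩ : p ∈ closure Ω \ U) : p ∈ (∅ : Set C2))
  · obtain ⟨x, hx, hmax⟩ := hcomp.exists_isMaxOn hne hρ.smooth.continuous.continuousOn
    refine ⟨-ρ x, by linarith [hcl x hx], fun p hp hps => hUP p ?_⟩
    by_contra hpU
    have := hmax (⟨hΩ p hp, hpU⟩ : p ∈ closure Ω \ U)
    simp only [mem_ofPred_eq] at this
    linarith

/-- The basic estimate near the boundary, for a plurisubharmonic function `lam` whose Levi form is
large near the Levi-flat set. -/
lemma exists_forall_nonneg_near_frontier (hbdd : Bornology.IsBounded Ω)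
    (hρ : IsDefiningFunction Ω ρ) (hpsc : IsLeviPseudoconvex Ω ρ) {σ c : ℝ} (hσ : 0 < σ)
    (hc : 0 < c)
    (hL : ∀ M : ℝ, ∃ lam : C2 → ℝ, ContDiff ℝ ∞ lam ∧ (∀ p, 0 ≤ lam p) ∧
      (∀ p ∈ Ω, lam p ≤ 1) ∧ (∀ p X, 0 ≤ realLevi lam p X) ∧
      ∀ q ∈ leviFlatSet Ω ρ, ∀ᶠ p in 𝓝 q, ∀ X, M * ‖X‖ ^ 2 ≤ realLevi lam p X) :
    ∃ lam : C2 → ℝ, ContDiff ℝ ∞ lam ∧ (∀ p, 0 ≤ lam p) ∧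
      (∀ p ∈ Ω, lam p ≤ 1) ∧ (∀ p X, 0 ≤ realLevi lam p X) ∧
      ∃ s : ℝ, 0 < s ∧ ∀ p, ρ p < 0 → -s < ρ p → ∀ X,
        0 ≤ -ρ p * realLevi ρ p X + σ * gradSq ρ p X + ρ p ^ 2 * (c * realLevi lam p X) := by
  obtain ⟨M, hM, hunif⟩ := exists_uniform_eventually_nonneg hbdd hρ hpsc hσ
  -- `M` is fixed before `lam` is chosen. The factor 4 pays for `‖X‖ > 1 / 2`, all that holds near
  -- the unit sphere.
  obtain ⟨lam, hsm, h0, h1, hpsh, hbig⟩ := hL (4 * M / c)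
  refine ⟨lam, hsm, h0, h1, hpsh, ?_⟩
  set P : C2 × C2 → Prop := fun y => ρ y.1 < 0 → 0 ≤ -ρ y.1 * realLevi ρ y.1 y.2 +
    σ * gradSq ρ y.1 y.2 + ρ y.1 ^ 2 * (c * realLevi lam y.1 y.2) with hPdef
  have hloc : ∀ x ∈ frontier Ω ×ˢ Metric.sphere (0 : C2) 1, ∀ᶠ y in 𝓝 x, P y := by
    rintro ⟨q, X⟩ ⟨hq, hX⟩
    have hX1 : ‖X‖ = 1 := by simpa using hX
    by_cases hqL : q ∈ leviFlatSet Ω ρ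
    · have hb : ∀ᶠ y : C2 × C2 in 𝓝 (q, X),
          ∀ X, 4 * M / c * ‖X‖ ^ 2 ≤ realLevi lam y.1 X :=
        (continuous_fst.tendsto (q, X)).eventually (hbig q hqL)
      have hnorm : ∀ᶠ y : C2 × C2 in 𝓝 (q, X), 1 / 2 < ‖y.2‖ :=
        continuous_snd.norm.continuousAt.eventually (lt_mem_nhds (by simp [hX1]; norm_num))
      filter_upwards [hb, hnorm, hunif q hq X hX1] with y hy hn hM' hneg
      refine (hM' hneg).trans ?_
      have h2 : M ≤ c * realLevi lam y.1 y.2 := calc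
        M ≤ 4 * M * ‖y.2‖ ^ 2 := by
          have h4 : 1 / 4 ≤ ‖y.2‖ ^ 2 := by nlinarith
          nlinarith [mul_le_mul_of_nonneg_left h4 hM]
        _ = c * (4 * M / c * ‖y.2‖ ^ 2) := by field_simp
        _ ≤ c * realLevi lam y.1 y.2 := by gcongr; exact hy y.2
      gcongr
    · have hpos : ∀ y : C2 × C2, 0 ≤ ρ y.1 ^ 2 * (c * realLevi lam y.1 y.2) := fun y => by
        have := hpsh y.1 y.2
        positivity
      rcases (gradSq_nonneg ρ q X).eq_or_lt with hg | hg
      · have hQ := realLevi_pos_of_notMem_leviFlatSet hρ hpsc hq hqL hg.symm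
          (by rintro rfl; simp at hX1)
        have hev : ∀ᶠ y : C2 × C2 in 𝓝 (q, X), 0 < realLevi ρ y.1 y.2 :=
          (contDiff_realLevi hρ.smooth (n := 0)).continuous.continuousAt.eventually
            (lt_mem_nhds hQ)
        filter_upwards [hev] with y hy hneg
        have h2 := gradSq_nonneg ρ y.1 y.2
        have h3 : 0 ≤ -ρ y.1 * realLevi ρ y.1 y.2 := mul_nonneg (by linarith) hy.le
        have h4 : 0 ≤ σ * gradSq ρ y.1 y.2 := by positivity
        linarith [hpos y]
      · filter_upwards [eventually_pos_of_gradSq_pos hρ hσ hq hg] with y hy _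
        linarith [hpos y]
  -- By the tube lemma, one neighbourhood of the boundary serves all unit vectors; homogeneity in
  -- `X` then gives all vectors.
  have hset : ∀ᶠ p in 𝓝ˢ (frontier Ω), ∀ X ∈ Metric.sphere (0 : C2) 1, P (p, X) := by
    have h := (eventually_nhdsSet_iff_forall (p := P)).2 hloc
    rw [(isCompact_frontier_of_isBounded hbdd).nhdsSet_prod_eq (isCompact_sphere _ _)] at h
    obtain ⟨p1, hp1, p2, hp2, hand⟩ := eventually_prod_iff.1 h
    filter_upwards [hp1] with p hp X hX
    exact hand hp (hp2.self_of_nhdsSet X hX)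
  obtain ⟨s, hs, hsP⟩ := exists_pos_forall_of_eventually_nhdsSet_frontier hbdd hρ hset
  refine ⟨s, hs, fun p hp hps X => ?_⟩
  by_cases hX : X = 0
  · subst hX
    simp [realLevi, gradSq]
  have hn : ‖X‖ ≠ 0 := norm_ne_zero_iff.2 hX
  have hunit : ‖‖X‖⁻¹ • X‖ = 1 := by
    rw [norm_smul, norm_inv, norm_norm, inv_mul_cancel₀ hn]
  have h := hsP p hp hps (‖X‖⁻¹ • X) (by simpa using hunit) hp
  simp only [realLevi_smul, gradSq_smul] at h
  have h5 : -ρ p * (‖X‖⁻¹ ^ 2 * realLevi ρ p X) + σ * (‖X‖⁻¹ ^ 2 * gradSq ρ p X) +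
      ρ p ^ 2 * (c * (‖X‖⁻¹ ^ 2 * realLevi lam p X)) = ‖X‖⁻¹ ^ 2 *
      (-ρ p * realLevi ρ p X + σ * gradSq ρ p X + ρ p ^ 2 * (c * realLevi lam p X)) := by ring
  rw [h5] at h
  exact nonneg_of_mul_nonneg_right h (by positivity)

end BoundaryEstimates

/-! ### Logarithmic potentials -/

section LogPotential

lemma fderiv_norm_sub_sq (a p X : C2) :
    fderiv ℝ (fun x => ‖x - a‖ ^ 2) p X = 2 * inner ℝ (p - a) X := by
  have h := ((hasFDerivAt_id (𝕜 := ℝ) p).sub_const a).norm_sq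
  have h' : HasFDerivAt (fun x : C2 => ‖x - a‖ ^ 2) _ p := h
  rw [h'.fderiv]
  simp [inner_sub_left]

lemma contDiff_norm_sub_sq (a : C2) {n : WithTop ℕ∞} :
    ContDiff ℝ n fun x : C2 => ‖x - a‖ ^ 2 :=
  (contDiff_id.sub contDiff_const).norm_sq ℝ

lemma fderiv_fderiv_norm_sub_sq (a p X Y : C2) :
    fderiv ℝ (fderiv ℝ fun x => ‖x - a‖ ^ 2) p X Y = 2 * inner ℝ X Y := by
  have h1 : (fderiv ℝ fun x => ‖x - a‖ ^ 2) = fun q => (2 : ℝ) • innerSL ℝ (q - a) := by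
    ext q X
    rw [fderiv_norm_sub_sq]
    simp [inner_sub_left]
  have h2 : HasFDerivAt (fun q => (2 : ℝ) • innerSL ℝ (q - a))
      ((2 : ℝ) • (innerSL ℝ : C2 →L[ℝ] C2 →L[ℝ] ℝ)) p :=
    (((innerSL ℝ : C2 →L[ℝ] C2 →L[ℝ] ℝ).hasFDerivAt.comp p
      ((hasFDerivAt_id p).sub_const a))).const_smul (2 : ℝ)
  rw [h1, h2.fderiv]
  simp only [smul_apply, smul_eq_mul]
  rfl

lemma norm_I_smul (X : C2) : ‖Complex.I • X‖ = ‖X‖ := by simp [norm_smul]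

lemma realLevi_norm_sub_sq (a p X : C2) :
    realLevi (fun x => ‖x - a‖ ^ 2) p X = 4 * ‖X‖ ^ 2 := by
  simp only [realLevi, fderiv_fderiv_norm_sub_sq, real_inner_self_eq_norm_sq, norm_I_smul]
  ring

/-- Cauchy–Schwarz for the complex inner product bounds both real terms at once. The resulting
constant 4 is what lets the estimate for `logPotential` stay positive. -/
lemma gradSq_norm_sub_sq_le (a p X : C2) :
    gradSq (fun x => ‖x - a‖ ^ 2) p X ≤ 4 * (‖p - a‖ ^ 2 * ‖X‖ ^ 2) := by
  simp only [gradSq, fderiv_norm_sub_sq]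
  have h1 : inner ℝ (p - a) X = (inner ℂ (p - a) X).re := by
    simp [PiLp.inner_apply]
    ring
  have h2 : inner ℝ (p - a) (Complex.I • X) = -(inner ℂ (p - a) X).im := by
    simp [PiLp.inner_apply]
    ring
  have h3 : ‖inner ℂ (p - a) X‖ ^ 2 ≤ (‖p - a‖ * ‖X‖) ^ 2 := by
    gcongr
    exact norm_inner_le_norm _ _
  rw [Complex.sq_norm, Complex.normSq_apply] at h3
  rw [h1, h2]
  nlinarith

/-- The plurisubharmonic function `log (1 + |p - a|² / r²)`. -/
def logPotential (a : C2) (r : ℝ) (p : C2) : ℝ := Real.log (1 + ‖p - a‖ ^ 2 / r ^ 2)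

lemma logPotential_nonneg (a : C2) (r : ℝ) (p : C2) : 0 ≤ logPotential a r p :=
  Real.log_nonneg (by have : 0 ≤ ‖p - a‖ ^ 2 / r ^ 2 := by positivity
                      linarith)

lemma contDiff_logPotential (a : C2) (r : ℝ) : ContDiff ℝ ∞ (logPotential a r) :=
  (contDiff_const.add ((contDiff_norm_sub_sq a).div_const _)).log fun p => by positivity

lemma realLevi_logPotential_ge (a : C2) {r : ℝ} (hr : 0 < r) (p X : C2) :
    4 * r ^ 2 / (r ^ 2 + ‖p - a‖ ^ 2) ^ 2 * ‖X‖ ^ 2 ≤ realLevi (logPotential a r) p X := by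
  have hpos : 0 < r ^ 2 + ‖p - a‖ ^ 2 := by positivity
  have hg : ∀ᶠ y in 𝓝 (‖p - a‖ ^ 2),
      HasDerivAt (fun y => Real.log (1 + y / r ^ 2)) ((r ^ 2 + y)⁻¹) y := by
    have hnear : ∀ᶠ y in 𝓝 (‖p - a‖ ^ 2), 0 < r ^ 2 + y :=
      (continuous_const.add continuous_id).continuousAt.eventually (lt_mem_nhds hpos)
    filter_upwards [hnear] with y hy
    have hne : 1 + y / r ^ 2 ≠ 0 := by
      have : 1 + y / r ^ 2 = (r ^ 2 + y) / r ^ 2 := by field_simp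
      rw [this]
      positivity
    refine ((((hasDerivAt_id y).div_const (r ^ 2)).const_add 1).log hne).congr_deriv ?_
    have h1 : 1 + y / r ^ 2 = (r ^ 2 + y) / r ^ 2 := by field_simp
    simp only [id, h1]
    field_simp
  have hg' : HasDerivAt (fun y => (r ^ 2 + y)⁻¹) (-1 / (r ^ 2 + ‖p - a‖ ^ 2) ^ 2)
      (‖p - a‖ ^ 2) :=
    ((hasDerivAt_id _).const_add (r ^ 2)).inv hpos.ne'
  have hcomp := realLevi_comp (contDiff_norm_sub_sq a).contDiffAt hg hg' X
  have heq : realLevi (logPotential a r) p X = _ := hcomp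
  rw [heq, realLevi_norm_sub_sq]
  have hle := gradSq_norm_sub_sq_le a p X
  have hstep : -1 / (r ^ 2 + ‖p - a‖ ^ 2) ^ 2 * (4 * (‖p - a‖ ^ 2 * ‖X‖ ^ 2)) ≤
      -1 / (r ^ 2 + ‖p - a‖ ^ 2) ^ 2 * gradSq (fun x => ‖x - a‖ ^ 2) p X := by
    rw [neg_div, neg_mul, neg_mul]
    gcongr
  refine le_trans (le_of_eq ?_) (add_le_add_right hstep _)
  field_simp
  ring

/-- A crude bound of order less than `x` is enough: `O(1/r)` potentials of weight `r²` then sum to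
`O(√r)`. -/
lemma log_one_add_sq_le {x : ℝ} (hx : 0 ≤ x) : Real.log (1 + x ^ 2) ≤ 4 * Real.sqrt x := by
  have hs := Real.sq_sqrt hx
  have hu := Real.sqrt_nonneg x
  set u := Real.sqrt x
  calc Real.log (1 + x ^ 2) ≤ Real.log ((1 + u) ^ 4) := by
        apply Real.log_le_log (by positivity)
        rw [← hs]
        nlinarith [pow_nonneg hu 2, pow_nonneg hu 3]
    _ = 4 * Real.log (1 + u) := by rw [Real.log_pow]; norm_num
    _ ≤ 4 * u := by
        have := Real.log_le_sub_one_of_pos (show 0 < 1 + u by positivity)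
        linarith

/-! ### Linear covering numbers and the bounded functions they provide -/

/-- `S` is covered, for each `r ∈ (0, 1]`, by `O(1 / r)` balls of radius `r` centred on `S`. -/
def HasLinearCovering (S : Set C2) : Prop :=
  ∃ C : ℝ, ∀ r : ℝ, 0 < r → r ≤ 1 → ∃ F : Finset C2,
    (F : Set C2) ⊆ S ∧ F.card * r ≤ C ∧ S ⊆ ⋃ a ∈ F, Metric.ball a r

lemma HasLinearCovering.union {S T : Set C2} (hS : HasLinearCovering S)
    (hT : HasLinearCovering T) : HasLinearCovering (S ∪ T) := by
  classical
  obtain ⟨C, hC⟩ := hS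
  obtain ⟨D, hD⟩ := hT
  refine ⟨C + D, fun r hr hr1 => ?_⟩
  obtain ⟨F, hFS, hF, hcF⟩ := hC r hr hr1
  obtain ⟨G, hGT, hG, hcG⟩ := hD r hr hr1
  refine ⟨F ∪ G, ?_, ?_, ?_⟩
  · rw [Finset.coe_union]
    exact union_subset_union hFS hGT
  · have : ((F ∪ G).card : ℝ) ≤ F.card + G.card := by exact_mod_cast Finset.card_union_le F G
    nlinarith
  · rw [Finset.set_biUnion_union]
    exact union_subset_union hcF hcG

lemma HasLinearCovering.iUnion {m : ℕ} {S : Fin m → Set C2} (h : ∀ i, HasLinearCovering (S i)) :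
    HasLinearCovering (⋃ i, S i) := by
  induction m with
  | zero => exact ⟨0, fun r _ _ => ⟨∅, by simp⟩⟩
  | succ m ih =>
    have : (⋃ i, S i) = S 0 ∪ ⋃ i : Fin m, S i.succ := by
      ext x
      simp [Fin.exists_fin_succ]
    rw [this]
    exact (h 0).union (ih fun i => h i.succ)

lemma Set.Finite.hasLinearCovering {S : Set C2} (hS : S.Finite) : HasLinearCovering S := by
  refine ⟨hS.toFinset.card, fun r hr hr1 => ⟨hS.toFinset, by simp, ?_, ?_⟩⟩
  · exact mul_le_of_le_one_right (by positivity) hr1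
  · intro x hx
    simp only [mem_iUnion]
    exact ⟨x, hS.mem_toFinset.2 hx, Metric.mem_ball_self hr⟩

lemma LipschitzOnWith.hasLinearCovering_image {f : ℝ → C2} {a b : ℝ} {K : NNReal} (hab : a < b)
    (hf : LipschitzOnWith K f (Icc a b)) : HasLinearCovering (f '' Icc a b) := by
  classical
  refine ⟨K * (b - a) + 3, fun r hr hr1 => ?_⟩
  -- This makes `K (b - a) / N < r`, so the images of the `N + 1` grid points, both end points
  -- included, are centres for radius `r`.
  set N : ℕ := ⌊K * (b - a) / r⌋₊ + 1 with hN
  have hba : 0 < b - a := sub_pos.2 hab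
  have hN0 : (0 : ℝ) < N := by rw [hN]; positivity
  have hNgt : K * (b - a) / r < N := by rw [hN]; push_cast; exact Nat.lt_floor_add_one _
  have hNle : (N : ℝ) ≤ K * (b - a) / r + 1 := by
    rw [hN]; push_cast
    have := Nat.floor_le (show 0 ≤ K * (b - a) / r by positivity)
    linarith
  have hmem : ∀ k : ℕ, k ≤ N → a + k * ((b - a) / N) ∈ Icc a b := by
    intro k hk
    have hk' : (k : ℝ) ≤ N := by exact_mod_cast hk
    refine ⟨by have : 0 ≤ k * ((b - a) / N) := by positivity
               linarith, ?_⟩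
    have : k * ((b - a) / N) ≤ N * ((b - a) / N) := by gcongr
    rw [mul_div_cancel₀ _ hN0.ne'] at this
    linarith
  refine ⟨(Finset.range (N + 1)).image fun k : ℕ => f (a + k * ((b - a) / N)), ?_, ?_, ?_⟩
  · intro x hx
    simp only [Finset.coe_image, Set.mem_image, Finset.mem_coe, Finset.mem_range] at hx
    obtain ⟨k, hk, rfl⟩ := hx
    exact ⟨_, hmem k (by omega), rfl⟩
  · have hcard : (((Finset.range (N + 1)).image
        fun k : ℕ => f (a + k * ((b - a) / N))).card : ℝ) ≤ N + 1 := by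
      exact_mod_cast Finset.card_image_le.trans (by simp)
    have h2 : K * (b - a) / r * r = K * (b - a) := by field_simp
    nlinarith
  · rintro _ ⟨t, ht, rfl⟩
    have hta : 0 ≤ (t - a) * N / (b - a) := by
      have := ht.1
      have : 0 ≤ t - a := by linarith
      positivity
    set k := ⌊(t - a) * N / (b - a)⌋₊ with hk
    have hk1 := Nat.floor_le hta
    have hk2 := Nat.lt_floor_add_one ((t - a) * N / (b - a))
    rw [← hk] at hk1 hk2
    rw [le_div_iff₀ hba] at hk1
    rw [div_lt_iff₀ hba] at hk2
    have hkN : k ≤ N := by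
      have : (k : ℝ) * (b - a) ≤ N * (b - a) := by nlinarith [ht.2]
      exact_mod_cast le_of_mul_le_mul_right this hba
    simp only [Finset.mem_image, Finset.mem_range, iUnion_exists, mem_iUnion]
    refine ⟨_, k, ⟨by omega, rfl⟩, ?_⟩
    rw [Metric.mem_ball]
    refine (hf.dist_le_mul t ht _ (hmem k hkN)).trans_lt ?_
    have hd : dist t (a + k * ((b - a) / N)) ≤ (b - a) / N := by
      rw [Real.dist_eq, abs_le]
      have e1 : k * ((b - a) / N) = k * (b - a) / N := by ring
      have e2 : (k * (b - a)) / N ≤ t - a := by rw [div_le_iff₀ hN0]; linarith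
      have e3 : t - a ≤ (k * (b - a)) / N + (b - a) / N := by
        rw [← add_div, le_div_iff₀ hN0]; linarith
      have e4 : 0 ≤ (b - a) / N := by positivity
      constructor <;> linarith
    calc (K : ℝ) * dist t (a + k * ((b - a) / N)) ≤ K * ((b - a) / N) := by gcongr
      _ < r := by
        rw [div_lt_iff₀ hr] at hNgt
        rw [← mul_div_assoc, div_lt_iff₀ hN0]
        linarith

lemma RealCurve.hasLinearCovering (γ : RealCurve) : HasLinearCovering γ.carrier := by
  have hd : Differentiable ℝ γ.toFun := γ.smooth.differentiable (by simp)
  obtain ⟨C, hC⟩ := isCompact_Icc.exists_bound_of_continuousOn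
    (γ.smooth.continuous_deriv (by simp)).continuousOn (s := Icc γ.a γ.b)
  refine LipschitzOnWith.hasLinearCovering_image (K := C.toNNReal) γ.lt ?_
  refine (convex_Icc _ _).lipschitzOnWith_of_nnnorm_deriv_le (fun x _ => hd x) fun x hx => ?_
  rw [← NNReal.coe_le_coe, coe_nnnorm]
  exact (hC x hx).trans (Real.le_coe_toNNReal C)

/-- A set with linear covering numbers carries bounded plurisubharmonic functions with arbitrarily
large Levi form. -/
theorem HasLinearCovering.exists_plurisubharmonic {S : Set C2} (hS : HasLinearCovering S)
    (hSb : Bornology.IsBounded S) {Ω : Set C2} (hΩ : Bornology.IsBounded Ω) (M : ℝ) :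
    ∃ lam : C2 → ℝ, ContDiff ℝ ∞ lam ∧ (∀ p, 0 ≤ lam p) ∧
      (∀ p ∈ Ω, lam p ≤ 1) ∧ (∀ p X, 0 ≤ realLevi lam p X) ∧
      ∀ q ∈ S, ∀ᶠ p in 𝓝 q, ∀ X, M * ‖X‖ ^ 2 ≤ realLevi lam p X := by
  wlog hM : 0 ≤ M generalizing M
  · obtain ⟨lam, h1, h2, h3, h4, -⟩ := this 0 le_rfl
    refine ⟨lam, h1, h2, h3, h4, fun q _ => Eventually.of_forall fun p X => ?_⟩
    exact (mul_nonpos_of_nonpos_of_nonneg (by linarith) (by positivity)).trans (h4 p X)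
  obtain ⟨R, hR0, hR⟩ := (hSb.union hΩ).exists_pos_norm_le
  obtain ⟨C, hC⟩ := hS
  -- This is the bound for the sum on `Ω`: at most `C / r` terms, each at most `M r² · 4 √(2R / r)`.
  have hlim : Tendsto (fun r => C * M * (4 * Real.sqrt (2 * R * r))) (𝓝[>] 0) (𝓝 0) := by
    have : ContinuousAt (fun r => C * M * (4 * Real.sqrt (2 * R * r))) 0 := by fun_prop
    have h := this.tendsto
    simp only [mul_zero, Real.sqrt_zero] at h
    exact h.mono_left nhdsWithin_le_nhds
  obtain ⟨r, hr1, hr2, hr⟩ := ((hlim.eventually (gt_mem_nhds one_pos)).and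
    ((Ioo_mem_nhdsGT (zero_lt_one (α := ℝ))) : ∀ᶠ r in 𝓝[>] (0 : ℝ), r ∈ Ioo 0 1)).exists
  obtain ⟨F, hFS, hFcard, hcov⟩ := hC r hr2 hr.le
  have hsmooth : ∀ a, ContDiff ℝ ∞ fun p => M * r ^ 2 * logPotential a r p := fun a =>
    contDiff_const.mul (contDiff_logPotential a r)
  have hlevi : ∀ p X, realLevi (fun p => ∑ a ∈ F, M * r ^ 2 * logPotential a r p) p X =
      ∑ a ∈ F, M * r ^ 2 * realLevi (logPotential a r) p X := by
    intro p X
    rw [realLevi_finset_sum F fun a _ => (hsmooth a).contDiffAt.of_le two_le_infty]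
    exact Finset.sum_congr rfl fun a _ =>
      realLevi_const_mul ((contDiff_logPotential a r).contDiffAt.of_le two_le_infty) _ _
  have hterm : ∀ a p X, 0 ≤ M * r ^ 2 * realLevi (logPotential a r) p X := fun a p X =>
    mul_nonneg (by positivity) (le_trans (by positivity) (realLevi_logPotential_ge a hr2 p X))
  refine ⟨fun p => ∑ a ∈ F, M * r ^ 2 * logPotential a r p, ContDiff.sum fun a _ => hsmooth a,
    fun p => Finset.sum_nonneg fun a _ => mul_nonneg (by positivity) (logPotential_nonneg a r p),
    fun p hp => ?_, fun p X => ?_, fun q hq => ?_⟩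
  · have hb : ∀ a ∈ F, M * r ^ 2 * logPotential a r p ≤ M * r * (4 * Real.sqrt (2 * R * r)) := by
      intro a ha
      have hd : ‖p - a‖ ≤ 2 * R := by
        have := norm_sub_le p a
        linarith [hR p (Or.inr hp), hR a (Or.inl (hFS ha))]
      have h1 : logPotential a r p ≤ 4 * Real.sqrt (2 * R / r) := by
        refine le_trans ?_ (log_one_add_sq_le (by positivity))
        unfold logPotential
        rw [← div_pow]
        gcongr
      have h2 : r * Real.sqrt (2 * R / r) = Real.sqrt (2 * R * r) := by
        rw [show 2 * R * r = r ^ 2 * (2 * R / r) by field_simp, Real.sqrt_mul (by positivity),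
          Real.sqrt_sq hr2.le]
      calc M * r ^ 2 * logPotential a r p ≤ M * r ^ 2 * (4 * Real.sqrt (2 * R / r)) := by gcongr
        _ = M * r * (4 * (r * Real.sqrt (2 * R / r))) := by ring
        _ = _ := by rw [h2]
    calc ∑ a ∈ F, M * r ^ 2 * logPotential a r p
        ≤ ∑ a ∈ F, M * r * (4 * Real.sqrt (2 * R * r)) := Finset.sum_le_sum hb
      _ = (F.card * r) * (M * (4 * Real.sqrt (2 * R * r))) := by
        rw [Finset.sum_const, nsmul_eq_mul]
        ring
      _ ≤ C * (M * (4 * Real.sqrt (2 * R * r))) := by gcongr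
      _ ≤ 1 := by linarith
  · rw [hlevi]
    exact Finset.sum_nonneg fun a _ => hterm a p X
  · obtain ⟨a, ha, hqa⟩ := mem_iUnion₂.1 (hcov hq)
    filter_upwards [Metric.isOpen_ball.mem_nhds hqa] with p hp X
    rw [hlevi]
    refine le_trans ?_ (Finset.single_le_sum (fun a _ => hterm a p X) ha)
    have hpa : ‖p - a‖ ^ 2 ≤ r ^ 2 := by
      have : ‖p - a‖ < r := by simpa [dist_eq_norm] using hp
      gcongr
    have h1 : 1 / r ^ 2 ≤ 4 * r ^ 2 / (r ^ 2 + ‖p - a‖ ^ 2) ^ 2 := by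
      rw [div_le_div_iff₀ (by positivity) (by positivity)]
      nlinarith [sq_nonneg ‖p - a‖]
    calc M * ‖X‖ ^ 2 = M * r ^ 2 * (1 / r ^ 2 * ‖X‖ ^ 2) := by field_simp
      _ ≤ M * r ^ 2 * (4 * r ^ 2 / (r ^ 2 + ‖p - a‖ ^ 2) ^ 2 * ‖X‖ ^ 2) := by gcongr
      _ ≤ _ := by
        gcongr
        exact realLevi_logPotential_ge a hr2 p X

end LogPotential

/-! ### Convex truncation and the matching change of defining function -/

section ConvexTruncation

/-- A smooth convex nondecreasing function that is constant on `(-∞, -2a]` and the identity on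
`[-a, ∞)`. -/
def convexTruncation (a t : ℝ) : ℝ := -a + ∫ x in (-a)..t, Real.smoothTransition (x / a + 2)

lemma contDiff_smoothTransition_div (a : ℝ) {n : ℕ∞} :
    ContDiff ℝ n fun x : ℝ => Real.smoothTransition (x / a + 2) :=
  Real.smoothTransition.contDiff.comp ((contDiff_id.div_const a).add contDiff_const)

lemma hasDerivAt_convexTruncation (a t : ℝ) :
    HasDerivAt (convexTruncation a) (Real.smoothTransition (t / a + 2)) t :=
  (((contDiff_smoothTransition_div a (n := 0)).continuous).integral_hasStrictDerivAt _ _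
    |>.hasDerivAt).const_add (-a)

lemma contDiff_convexTruncation (a : ℝ) : ContDiff ℝ ∞ (convexTruncation a) := by
  rw [contDiff_infty_iff_deriv]
  refine ⟨fun t => (hasDerivAt_convexTruncation a t).differentiableAt, ?_⟩
  rw [show deriv (convexTruncation a) = _ from
    funext fun t => (hasDerivAt_convexTruncation a t).deriv]
  exact contDiff_smoothTransition_div a

lemma convexTruncation_eq_self {a t : ℝ} (ha : 0 < a) (ht : -a ≤ t) :
    convexTruncation a t = t := by
  have h : ∫ x in (-a)..t, Real.smoothTransition (x / a + 2) = ∫ x in (-a)..t, (1 : ℝ) := by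
    refine intervalIntegral.integral_congr fun x hx => ?_
    rw [uIcc_of_le ht] at hx
    refine Real.smoothTransition.one_of_one_le ?_
    have : -1 ≤ x / a := by rw [le_div_iff₀ ha]; linarith [hx.1]
    linarith
  rw [convexTruncation, h]
  simp

lemma monotone_convexTruncation (a : ℝ) : Monotone (convexTruncation a) :=
  monotone_of_deriv_nonneg (fun t => (hasDerivAt_convexTruncation a t).differentiableAt) fun t => by
    rw [(hasDerivAt_convexTruncation a t).deriv]
    exact Real.smoothTransition.nonneg _

lemma convexTruncation_neg {a t : ℝ} (ha : 0 < a) (ht : t < 0) : convexTruncation a t < 0 := by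
  rcases le_total (-a) t with h | h
  · rwa [convexTruncation_eq_self ha h]
  · refine (monotone_convexTruncation a h).trans_lt ?_
    rw [convexTruncation_eq_self ha le_rfl]
    linarith

lemma deriv_smoothTransition_div_nonneg {a : ℝ} (ha : 0 < a) (t : ℝ) :
    0 ≤ deriv (fun x : ℝ => Real.smoothTransition (x / a + 2)) t := by
  refine Monotone.deriv_nonneg fun x y hxy => Real.smoothTransition.monotone ?_
  gcongr

/-- The reparametrization of defining functions that corresponds to `convexTruncation` applied to
`-(-x) ^ τ`. -/
def truncatedIdentity (τ a x : ℝ) : ℝ :=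
  if 0 ≤ x then x else -(-convexTruncation a (-(-x) ^ τ)) ^ τ⁻¹

variable {τ a : ℝ}

lemma truncatedIdentity_of_neg {x : ℝ} (hx : x < 0) :
    truncatedIdentity τ a x = -(-convexTruncation a (-(-x) ^ τ)) ^ τ⁻¹ :=
  if_neg hx.not_ge

lemma truncatedIdentity_neg (ha : 0 < a) {x : ℝ} (hx : x < 0) :
    truncatedIdentity τ a x < 0 := by
  rw [truncatedIdentity_of_neg hx, neg_lt_zero]
  have := convexTruncation_neg ha
    (neg_lt_zero.2 (Real.rpow_pos_of_pos (neg_pos.2 hx) τ))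
  exact Real.rpow_pos_of_pos (neg_pos.2 this) _

lemma truncatedIdentity_rpow (hτ : 0 < τ) (ha : 0 < a) {x : ℝ} (hx : x < 0) :
    -(-truncatedIdentity τ a x) ^ τ = convexTruncation a (-(-x) ^ τ) := by
  have := convexTruncation_neg ha
    (neg_lt_zero.2 (Real.rpow_pos_of_pos (neg_pos.2 hx) τ))
  rw [truncatedIdentity_of_neg hx, neg_neg, ← Real.rpow_mul (by linarith),
    inv_mul_cancel₀ hτ.ne', Real.rpow_one, neg_neg]

lemma truncatedIdentity_eq_self (hτ : 0 < τ) (ha : 0 < a) {x : ℝ} (hx : -a ^ τ⁻¹ ≤ x) :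
    truncatedIdentity τ a x = x := by
  rcases le_or_gt 0 x with h | h
  · exact if_pos h
  · have h1 : (-x) ^ τ ≤ a := by
      calc (-x) ^ τ ≤ (a ^ τ⁻¹) ^ τ := by
            apply Real.rpow_le_rpow <;> linarith
        _ = a := by rw [← Real.rpow_mul ha.le, inv_mul_cancel₀ hτ.ne', Real.rpow_one]
    rw [truncatedIdentity_of_neg h, convexTruncation_eq_self ha (by linarith), neg_neg,
      ← Real.rpow_mul (by linarith), mul_inv_cancel₀ hτ.ne', Real.rpow_one, neg_neg]

lemma truncatedIdentity_neg_iff (ha : 0 < a) {x : ℝ} : truncatedIdentity τ a x < 0 ↔ x < 0 := by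
  refine ⟨fun h => ?_, truncatedIdentity_neg ha⟩
  by_contra hx
  rw [truncatedIdentity, if_pos (not_lt.1 hx)] at h
  exact hx h

lemma truncatedIdentity_eq_zero_iff (ha : 0 < a) {x : ℝ} :
    truncatedIdentity τ a x = 0 ↔ x = 0 := by
  rcases lt_or_ge x 0 with hx | hx
  · exact iff_of_false (truncatedIdentity_neg ha hx).ne hx.ne
  · rw [truncatedIdentity, if_pos hx]

lemma truncatedIdentity_eventuallyEq (hτ : 0 < τ) (ha : 0 < a) {x : ℝ} (hx : 0 ≤ x) :
    truncatedIdentity τ a =ᶠ[𝓝 x] id := by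
  have : -a ^ τ⁻¹ < x := (neg_lt_zero.2 (Real.rpow_pos_of_pos ha _)).trans_le hx
  filter_upwards [lt_mem_nhds this] with y hy
  exact truncatedIdentity_eq_self hτ ha hy.le

/-- The powers are singular only at `0`, and there the function is locally the identity. -/
lemma contDiff_truncatedIdentity (hτ : 0 < τ) (ha : 0 < a) :
    ContDiff ℝ ∞ (truncatedIdentity τ a) := by
  refine contDiff_iff_contDiffAt.2 fun x => ?_
  rcases lt_or_ge x 0 with hx | hx
  · have hev : truncatedIdentity τ a =ᶠ[𝓝 x]
        fun x => -(-convexTruncation a (-(-x) ^ τ)) ^ τ⁻¹ := by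
      filter_upwards [gt_mem_nhds hx] with y hy
      exact truncatedIdentity_of_neg hy
    refine ContDiffAt.congr_of_eventuallyEq ?_ hev
    have h1 : ContDiffAt ℝ ∞ (fun x : ℝ => -(-x) ^ τ) x :=
      (contDiffAt_id.neg.rpow_const_of_ne (neg_pos.2 hx).ne').neg
    have h2 : ContDiffAt ℝ ∞ (fun x : ℝ => -convexTruncation a (-(-x) ^ τ)) x :=
      ((contDiff_convexTruncation a).contDiffAt.comp x h1).neg
    refine (h2.rpow_const_of_ne ?_).neg
    have := convexTruncation_neg ha
      (neg_lt_zero.2 (Real.rpow_pos_of_pos (neg_pos.2 hx) τ))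
    linarith
  · exact contDiffAt_id.congr_of_eventuallyEq (truncatedIdentity_eventuallyEq hτ ha hx)

end ConvexTruncation

/-! ### The defining function and its Levi form -/

section Construction

lemma realLevi_congr {f g : C2 → ℝ} {p : C2} (h : f =ᶠ[𝓝 p] g) (X : C2) :
    realLevi f p X = realLevi g p X := by
  simp only [realLevi, h.fderiv.fderiv_eq]

variable {Ω : Set C2} {ρ lam : C2 → ℝ} {τ c : ℝ}

/-- Here `x` stands for a component of `∂ρ / ρ` and `y` for one of `∂lam`. The difference is a
quadratic form with `x²`-coefficient `(1 - τ) / 2`; multiply by it and complete the square. -/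
lemma cross_term_le {τ μ x y : ℝ} (h0 : 0 < τ) (h1 : τ < 1) (hμ : 0 ≤ μ) (hμ1 : 3 * μ ≤ 1 - τ) :
    τ * (x - μ * y) ^ 2 ≤ (1 + τ) / 2 * x ^ 2 + μ * y ^ 2 := by
  have h2 : τ * μ ≤ 1 / 3 := by nlinarith
  have h3 : τ ^ 2 * μ ≤ (1 - τ) / 2 * (1 - τ * μ) := by
    have h4 : τ ^ 2 * μ ≤ 1 * μ := by gcongr; nlinarith
    have h5 : (1 - τ) / 2 * (2 / 3) ≤ (1 - τ) / 2 * (1 - τ * μ) := by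
      apply mul_le_mul_of_nonneg_left <;> linarith
    linarith
  have hσ : 0 < (1 - τ) / 2 := by linarith
  have key : (1 - τ) / 2 * ((1 + τ) / 2 * x ^ 2 + μ * y ^ 2 - τ * (x - μ * y) ^ 2) =
      ((1 - τ) / 2 * x + τ * μ * y) ^ 2 +
        μ * y ^ 2 * ((1 - τ) / 2 * (1 - τ * μ) - τ ^ 2 * μ) := by ring
  have hnn : 0 ≤ (1 - τ) / 2 * ((1 + τ) / 2 * x ^ 2 + μ * y ^ 2 - τ * (x - μ * y) ^ 2) := by
    rw [key]
    have : 0 ≤ (1 - τ) / 2 * (1 - τ * μ) - τ ^ 2 * μ := by linarith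
    positivity
  linarith [nonneg_of_mul_nonneg_right hnn hσ]

/-- The logarithm of `-(ρ e^{-φ})` with `φ = c e^lam`. -/
def logDistance (ρ lam : C2 → ℝ) (c : ℝ) (p : C2) : ℝ :=
  Real.log (-ρ p) + -c * Real.exp (lam p)

lemma contDiffAt_logDistance (hρ : ContDiff ℝ ∞ ρ) (hlam : ContDiff ℝ ∞ lam) {p : C2}
    (hp : ρ p < 0) : ContDiffAt ℝ ∞ (logDistance ρ lam c) p :=
  (hρ.contDiffAt.neg.log (neg_pos.2 hp).ne').add (contDiffAt_const.mul hlam.contDiffAt.exp)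

lemma realLevi_logDistance_add_le (hρ : ContDiff ℝ ∞ ρ) (hlam : ContDiff ℝ ∞ lam)
    (h0 : 0 < τ) (h1 : τ < 1) (hc : c = (1 - τ) / 9) {p X : C2} (hp : ρ p < 0)
    (hlam0 : 0 ≤ lam p) (hlam1 : lam p ≤ 1) (hQ : 0 ≤ realLevi lam p X)
    (hest : 0 ≤ -ρ p * realLevi ρ p X + (1 - τ) / 2 * gradSq ρ p X +
      ρ p ^ 2 * (c * realLevi lam p X)) :
    realLevi (logDistance ρ lam c) p X + τ * gradSq (logDistance ρ lam c) p X ≤ 0 := by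
  have hρ2 : ContDiffAt ℝ 2 ρ p := hρ.contDiffAt.of_le two_le_infty
  have hl2 : ContDiffAt ℝ 2 lam p := hlam.contDiffAt.of_le two_le_infty
  have hρd := hρ2.eventually_hasFDerivAt.self_of_nhds
  have hld := hl2.eventually_hasFDerivAt.self_of_nhds
  have hne : ρ p ≠ 0 := hp.ne
  have hglog : ∀ y : ℝ, y < 0 → HasDerivAt (fun y => Real.log (-y)) y⁻¹ y := by
    intro y hy
    refine ((hasDerivAt_id y).neg.log (neg_pos.2 hy).ne').congr_deriv ?_
    simp [neg_div_neg_eq]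
  have hgexp : ∀ y : ℝ, HasDerivAt (fun y => -c * Real.exp y) (-c * Real.exp y) y := fun y =>
    (Real.hasDerivAt_exp y).const_mul (-c)
  have hL1 : realLevi (fun x => Real.log (-ρ x)) p X =
      (ρ p)⁻¹ * realLevi ρ p X + -(ρ p ^ 2)⁻¹ * gradSq ρ p X :=
    realLevi_comp hρ2 ((gt_mem_nhds hp).mono hglog) (hasDerivAt_inv hne) X
  have hL2 : realLevi (fun x => -c * Real.exp (lam x)) p X =
      -c * Real.exp (lam p) * realLevi lam p X + -c * Real.exp (lam p) * gradSq lam p X :=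
    realLevi_comp hl2 (Eventually.of_forall hgexp) (hgexp _) X
  have hL : realLevi (logDistance ρ lam c) p X = _ :=
    realLevi_add (hρ2.neg.log (neg_pos.2 hp).ne') (contDiffAt_const.mul hl2.exp) X
  have hD : HasFDerivAt (logDistance ρ lam c)
      ((ρ p)⁻¹ • fderiv ℝ ρ p + (-c * Real.exp (lam p)) • fderiv ℝ lam p) p :=
    ((hglog _ hp).comp_hasFDerivAt p hρd).add ((hgexp _).comp_hasFDerivAt p hld)
  rw [hL, hL1, hL2]
  simp only [gradSq, hD.fderiv, add_apply, smul_apply, smul_eq_mul] at hest ⊢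
  -- From `1 ≤ e^lam ≤ 3` follows `c ≤ μ ≤ 3c = (1 - τ) / 3`, whence the 9 in `c`. The exponential
  -- supplies the term `-μ |∂lam|²` that absorbs the gradient.
  have hexp1 : 1 ≤ Real.exp (lam p) := Real.one_le_exp hlam0
  have hexp3 : Real.exp (lam p) ≤ 3 :=
    (Real.exp_le_exp.2 hlam1).trans Real.exp_one_lt_three.le
  have hc0 : 0 < c := by rw [hc]; linarith
  set μ := c * Real.exp (lam p) with hμ
  have hμc : c ≤ μ := by nlinarith
  have hμ3 : 3 * μ ≤ 1 - τ := by
    have : μ ≤ c * 3 := mul_le_mul_of_nonneg_left hexp3 hc0.le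
    rw [hc] at this
    linarith
  rw [show -c * Real.exp (lam p) = -μ by rw [hμ]; ring]
  set A := fderiv ℝ ρ p X
  set A' := fderiv ℝ ρ p (Complex.I • X)
  set B := fderiv ℝ lam p X
  set B' := fderiv ℝ lam p (Complex.I • X)
  have e1 := cross_term_le (x := (ρ p)⁻¹ * A) (y := B) h0 h1 (hc0.le.trans hμc) hμ3
  have e2 := cross_term_le (x := (ρ p)⁻¹ * A') (y := B') h0 h1 (hc0.le.trans hμc) hμ3
  have e3 : c * realLevi lam p X ≤ μ * realLevi lam p X :=
    mul_le_mul_of_nonneg_right hμc hQ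
  have e4 : 0 ≤ (ρ p ^ 2)⁻¹ * (-ρ p * realLevi ρ p X + (1 - τ) / 2 * (A ^ 2 + A' ^ 2) +
      ρ p ^ 2 * (c * realLevi lam p X)) := by positivity
  have e5 : (ρ p ^ 2)⁻¹ * (-ρ p * realLevi ρ p X + (1 - τ) / 2 * (A ^ 2 + A' ^ 2) +
      ρ p ^ 2 * (c * realLevi lam p X)) = -((ρ p)⁻¹ * realLevi ρ p X) +
      (1 - τ) / 2 * (((ρ p)⁻¹ * A) ^ 2 + ((ρ p)⁻¹ * A') ^ 2) + c * realLevi lam p X := by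
    field_simp
  have e6 : (ρ p ^ 2)⁻¹ * (A ^ 2 + A' ^ 2) = ((ρ p)⁻¹ * A) ^ 2 + ((ρ p)⁻¹ * A') ^ 2 := by
    field_simp
  rw [e5] at e4
  rw [neg_mul (ρ p ^ 2)⁻¹, e6]
  linarith

lemma realLevi_neg_exp_nonneg {w : C2 → ℝ} {p X : C2} (hw : ContDiffAt ℝ 2 w p) (h0 : 0 < τ)
    (h : realLevi w p X + τ * gradSq w p X ≤ 0) :
    0 ≤ realLevi (fun x => -Real.exp (τ * w x)) p X := by
  have hg : ∀ k y : ℝ, HasDerivAt (fun y => -(k * Real.exp (τ * y)))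
      (-(k * τ * Real.exp (τ * y))) y := by
    intro k y
    refine ((((hasDerivAt_id y).const_mul τ).exp.const_mul k).neg).congr_deriv ?_
    simp only [id, mul_one]
    ring
  have hcomp := realLevi_comp hw (Eventually.of_forall (hg 1)) (hg (1 * τ) _) X
  simp only [one_mul] at hcomp
  rw [hcomp]
  have : -(τ * Real.exp (τ * w p)) * realLevi w p X +
      -(τ * τ * Real.exp (τ * w p)) * gradSq w p X =
      τ * Real.exp (τ * w p) * -(realLevi w p X + τ * gradSq w p X) := by ring
  rw [this]
  exact mul_nonneg (by positivity) (by linarith)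

/-- Convexity takes care of the gradient term, and where `u ≤ -2a` the first derivative of the
truncation vanishes. -/
lemma realLevi_convexTruncation_nonneg {u : C2 → ℝ} {p X : C2} {a : ℝ} (ha : 0 < a)
    (hu : ContDiffAt ℝ 2 u p) (h : -(2 * a) < u p → 0 ≤ realLevi u p X) :
    0 ≤ realLevi (fun x => convexTruncation a (u x)) p X := by
  rw [realLevi_comp hu (Eventually.of_forall (hasDerivAt_convexTruncation a))
    ((((contDiff_smoothTransition_div a (n := 1)).differentiable (by simp)) _).hasDerivAt) X]
  refine add_nonneg ?_ (mul_nonneg (deriv_smoothTransition_div_nonneg ha _) (gradSq_nonneg _ _ _))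
  by_cases hup : -(2 * a) < u p
  · exact mul_nonneg (Real.smoothTransition.nonneg _) (h hup)
  · rw [Real.smoothTransition.zero_of_nonpos, zero_mul]
    have : u p / a ≤ -2 := by rw [div_le_iff₀ ha]; linarith
    linarith

lemma isDefiningFunction_truncatedIdentity_comp (hρ : IsDefiningFunction Ω ρ)
    (hlam : ContDiff ℝ ∞ lam) {a : ℝ} (h0 : 0 < τ) (ha : 0 < a) :
    IsDefiningFunction Ω
      fun p => truncatedIdentity τ a (ρ p * Real.exp (-(c * Real.exp (lam p)))) := by
  have hE : ContDiff ℝ ∞ fun p => Real.exp (-(c * Real.exp (lam p))) :=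
    (contDiff_const.mul hlam.exp).neg.exp
  refine ⟨(contDiff_truncatedIdentity h0 ha).comp (hρ.smooth.mul hE), ?_, ?_, fun p hp => ?_⟩
  · rw [hρ.eq_neg]
    ext p
    simp only [mem_ofPred_eq, truncatedIdentity_neg_iff ha]
    refine ⟨fun h => mul_neg_of_neg_of_pos h (Real.exp_pos _), fun h => ?_⟩
    by_contra hn
    exact h.not_ge (mul_nonneg (not_lt.1 hn) (Real.exp_pos _).le)
  · rw [hρ.frontier_eq]
    ext p
    simp only [mem_ofPred_eq, truncatedIdentity_eq_zero_iff ha]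
    simp [Real.exp_ne_zero]
  · have hp0 : ρ p = 0 := by rw [hρ.frontier_eq] at hp; exact hp
    have hev : (fun p => truncatedIdentity τ a (ρ p * Real.exp (-(c * Real.exp (lam p)))))
        =ᶠ[𝓝 p] fun p => ρ p * Real.exp (-(c * Real.exp (lam p))) :=
      (hρ.smooth.mul hE).continuous.continuousAt.eventually
        (truncatedIdentity_eventuallyEq h0 ha (by simp [hp0]))
    have hd := ((hρ.smooth.differentiable (by simp)) p).hasFDerivAt.fun_mul
      ((hE.differentiable (by simp)) p).hasFDerivAt
    rw [hev.fderiv_eq, hd.fderiv, hp0, zero_smul, zero_add]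
    exact smul_ne_zero (Real.exp_ne_zero _) (hρ.fderiv_ne_zero p hp)

end Construction

/-! ### Every exponent below one is attained -/

section Index

variable {Ω : Set C2} {ρ : C2 → ℝ}

theorem mem_dfExponents_of_hasLinearCovering (hbdd : Bornology.IsBounded Ω)
    (hρ : IsDefiningFunction Ω ρ) (hpsc : IsLeviPseudoconvex Ω ρ)
    (hcov : HasLinearCovering (leviFlatSet Ω ρ)) {τ : ℝ} (h0 : 0 < τ) (h1 : τ < 1) :
    τ ∈ dfExponents Ω := by
  obtain ⟨c, hc⟩ : ∃ c, c = (1 - τ) / 9 := ⟨_, rfl⟩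
  have hc0 : 0 < c := by rw [hc]; linarith
  obtain ⟨lam, hlam, hlam0, hlam1, hpsh, s, hs, hest⟩ :=
    exists_forall_nonneg_near_frontier hbdd hρ hpsc (σ := (1 - τ) / 2) (by linarith) hc0
      (hcov.exists_plurisubharmonic (isCompact_leviFlatSet hρ hbdd).isBounded hbdd)
  have hΩ : ∀ p, p ∈ Ω ↔ ρ p < 0 := fun p => by
    conv_lhs => rw [hρ.eq_neg]
    rfl
  have hopen : IsOpen Ω := by
    rw [hρ.eq_neg]
    exact isOpen_lt hρ.smooth.continuous continuous_const
  -- Where `ρ ≤ -s`, the bound `e^lam ≤ 3` gives `-r ≥ s e^(-3c)`, that is `-(-r)^τ ≤ -2a`. The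
  -- truncation is therefore flat wherever the boundary estimate is missing.
  set a : ℝ := (s * Real.exp (-(3 * c))) ^ τ / 2 with ha
  have ha0 : 0 < a := by positivity
  set w := logDistance ρ lam c with hw
  have hexpw : ∀ p, ρ p < 0 → -(ρ p * Real.exp (-(c * Real.exp (lam p)))) = Real.exp (w p) := by
    intro p hp
    rw [hw, logDistance, Real.exp_add, Real.exp_log (neg_pos.2 hp)]
    ring_nf
  have hrpow : ∀ p, ρ p < 0 →
      (-(ρ p * Real.exp (-(c * Real.exp (lam p))))) ^ τ = Real.exp (τ * w p) := by
    intro p hp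
    rw [hexpw p hp, ← Real.exp_mul, mul_comm]
  refine ⟨h0, h1, fun p => truncatedIdentity τ a (ρ p * Real.exp (-(c * Real.exp (lam p)))),
    isDefiningFunction_truncatedIdentity_comp hρ hlam h0 ha0, ?_⟩
  have heq : ∀ p ∈ Ω,
      (fun p => -(-truncatedIdentity τ a (ρ p * Real.exp (-(c * Real.exp (lam p))))) ^ τ)
      =ᶠ[𝓝 p] fun p => convexTruncation a (-Real.exp (τ * w p)) := by
    intro p hp
    filter_upwards [hopen.mem_nhds hp] with q hq
    have hq' := (hΩ q).1 hq
    rw [truncatedIdentity_rpow h0 ha0 (mul_neg_of_neg_of_pos hq' (Real.exp_pos _)), hrpow q hq']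
  have hwsm : ∀ p ∈ Ω, ContDiffAt ℝ 2 w p := fun p hp =>
    (contDiffAt_logDistance hρ.smooth hlam ((hΩ p).1 hp)).of_le two_le_infty
  have husm : ∀ p ∈ Ω, ContDiffAt ℝ 2 (fun p => -Real.exp (τ * w p)) p := fun p hp =>
    (contDiffAt_const.mul (hwsm p hp)).exp.neg
  refine plurisubharmonicOn_of_realLevi_nonneg hopen (fun p hp => ?_) fun p hp X => ?_
  · refine ContDiffAt.contDiffWithinAt (ContDiffAt.congr_of_eventuallyEq ?_ (heq p hp))
    exact ((contDiff_convexTruncation a).contDiffAt.of_le two_le_infty).comp p (husm p hp)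
  · have hp' := (hΩ p).1 hp
    rw [realLevi_congr (heq p hp)]
    refine realLevi_convexTruncation_nonneg ha0 (husm p hp) fun hfar => ?_
    refine realLevi_neg_exp_nonneg (hwsm p hp) h0 ?_
    refine realLevi_logDistance_add_le hρ.smooth hlam h0 h1 hc hp' (hlam0 p) (hlam1 p hp)
      (hpsh p X) (hest p hp' ?_ X)
    by_contra hns
    have hle : s * Real.exp (-(3 * c)) ≤ -(ρ p * Real.exp (-(c * Real.exp (lam p)))) := by
      have hexp3 : Real.exp (lam p) ≤ 3 :=
        (Real.exp_le_exp.2 (hlam1 p hp)).trans Real.exp_one_lt_three.le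
      rw [← neg_mul (ρ p)]
      have : c * Real.exp (lam p) ≤ 3 * c := by nlinarith
      exact mul_le_mul (by linarith) (Real.exp_le_exp.2 (by linarith)) (Real.exp_pos _).le
        (by linarith)
    have := Real.rpow_le_rpow (by positivity) hle h0.le
    rw [hrpow p hp'] at this
    simp only [ha] at hfar
    linarith

theorem dfIndex_eq_one_of_hasLinearCovering (hbdd : Bornology.IsBounded Ω)
    (hρ : IsDefiningFunction Ω ρ) (hpsc : IsLeviPseudoconvex Ω ρ)
    (hcov : HasLinearCovering (leviFlatSet Ω ρ)) : dfIndex Ω = 1 := by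
  have : dfExponents Ω = Ioo 0 1 := Subset.antisymm (fun τ h => ⟨h.1, h.2.1⟩)
    fun τ h => mem_dfExponents_of_hasLinearCovering hbdd hρ hpsc hcov h.1 h.2
  rw [dfIndex, this, csSup_Ioo one_pos]

end Index

end

theorem mainTheorem8 (Ω : Set C2) (ρ : C2 → ℝ)
    (hbdd : Bornology.IsBounded Ω) (hconn : IsConnected Ω)
    (hρ : IsDefiningFunction Ω ρ) (hpsc : IsLeviPseudoconvex Ω ρ) :
    ((∀ p ∈ leviFlatSet Ω ρ, IsIsolatedPt (leviFlatSet Ω ρ) p) → dfIndex Ω = 1) ∧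
    (∀ (P : Set C2) (m : ℕ) (Γ : Fin m → RealCurve),
      P.Finite →
      (∀ p ∈ P, IsIsolatedPt (leviFlatSet Ω ρ) p) →
      (∀ i j : Fin m, i ≠ j → Disjoint (Γ i).carrier (Γ j).carrier) →
      (∀ i : Fin m, (Γ i).IsTransversal (tangentialField ρ)) →
      leviFlatSet Ω ρ = P ∪ ⋃ i : Fin m, (Γ i).carrier →
      dfIndex Ω = 1) := by
  refine ⟨fun h => ?_, fun P m Γ hP _ _ _ hΓ => ?_⟩
  · exact dfIndex_eq_one_of_hasLinearCovering hbdd hρ hpsc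
      (finite_leviFlatSet_of_isolated hρ hbdd h).hasLinearCovering
  · refine dfIndex_eq_one_of_hasLinearCovering hbdd hρ hpsc ?_
    rw [hΓ]
    exact hP.hasLinearCovering.union (HasLinearCovering.iUnion fun i => (Γ i).hasLinearCovering)
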